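/- Let $\mathcal G=(Q,A,\sigma,\gamma)$ be a finite directed graph: $Q$ (states) and $A$ (arrows) are finite sets and $\sigma,\gamma:A\to Q$ are the source and goal maps. A path of length $n$ is a word $w=(w_1,\dots,w_n)\in A^n$ with $\gamma(w_k)=\sigma(w_{k+1})$ for $1\le k<n$. Write $W_n^q$ for the set of paths of length $n$ starting at $q$ (that is, $\sigma(w_1)=q$; the empty path starts at every state) and $W_n^{q,q'}$ for the set of those which moreover end at $q'$ (that is, $\gamma(w_n)=q'$; the empty path goes from $q$ to $q'$ only when $q=q'$). Assume that $\mathcal G$ is connected: for all $q,q'\in Q$ there is $n\ge 0$ with $W_n^{q,q'}\neq\emptyset$. Let $\mathcal E=\mathbb R^A$ and $\mathcal V=\mathbb R^Q$ with their standard inner products. For $w\in A^n$ let $\mathscr P(w)\in\mathcal E$ be the vector such that $\mathscr P(w)(a)$ is the number of occurrences of $a$ in $w$. For $\theta\in\mathcal E$ let $L_\theta$ be the operator on $\mathcal V$ given by $$(L_\theta f)(q)=\sum_{a\in A,\ \sigma(a)=q}e^{-\theta(a)}f(\gamma(a)),$$ and let $\lambda(\theta)$ be its spectral radius (the largest modulus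 of a complex eigenvalue). Let $\nabla:\mathcal V\to\mathcal E$, $\nabla f(a)=f(\gamma(a))-f(\sigma(a))$, let $\mathcal E_0=(\mathbb R\mathbf 1+\nabla\mathcal V)^\perp\subset\mathcal E$, and let $r=\dim\mathcal E_0$. Let $p$ be the greatest common divisor of the set $\{n\in\mathbb N: W_n^{q,q}\ne\emptyset\}$, which does not depend on $q$, and, for $q\in Q$ and $n\ge 0$, let $Q_n^q$ be the set of $q'\in Q$ such that $W_m^{q,q'}\neq\emptyset$ for some $m\ge 0$ with $m\equiv n \pmod p$. Let $\theta\in\mathcal E$ with $\lambda(\theta)=1$. Then $\lambda$ is differentiable at $\theta$; put $x_\theta=-d_\theta\log\lambda\in\mathcal E$, where the dual of $\mathcal E$ is identified with $\mathcal E$ by the inner product. There is a unique pair $(\varphi_\theta,f_\theta)$ of everywhere positive functions on $Q$ with $$L_\theta f_\theta=\lambda(\theta)f_\theta,\qquad L_\theta^*\varphi_\theta=\lambda(\theta)\varphi_\theta,\qquad \langle\varphi_\theta,\mathbf 1\rangle=1=\langle\varphi_\theta,f_\theta\rangle .$$ Moreover: 1. For every $q\in Q$, $$\frac1n\sum_{w\in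 W_n^q}e^{-\langle\theta,\mathscr P(w)\rangle}\bigl(\mathscr P(w)-n x_\theta\bigr)\xrightarrow[n\to\infty]{}0 .$$ 2. There is a positive definite quadratic form $\chi_\theta$ on $\mathcal E_0$ such that, for every $q\in Q$ and every continuous compactly supported function $g:\mathcal E\to\mathbb R$, $$\sum_{w\in W_n^q}e^{-\langle\theta,\mathscr P(w)\rangle}g\!\left(\frac{\mathscr P(w)-n x_\theta}{\sqrt n}\right)-\frac{p\,\langle\varphi_\theta,\mathbf 1_{Q_n^q}\rangle f_\theta(q)}{(2\pi)^{r/2}}\int_{\mathcal E_0}\exp\!\left(-\tfrac12\chi_\theta(y)\right)g(y)\,dy\xrightarrow[n\to\infty]{}0,$$ where $dy$ is the Lebesgue measure on $\mathcal E_0$ for which the unit hypercubes of the Euclidean space $(\mathcal E_0,\chi_\theta)$ have measure $1$. -/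

import Mathlib

open MeasureTheory Filter Topology
open scoped RealInnerProductSpace

/-- A directed graph with set of states `Q` and set of arrows `A`: every arrow has a source and
a goal. Loops and parallel arrows are allowed. -/
structure ArrowGraph (Q A : Type*) where
  source : A → Q
  goal : A → Q

namespace ArrowGraph

variable {Q A : Type*} (G : ArrowGraph Q A)

/-- `(w₀, …, wₙ₋₁)` is a path of length `n`: the goal of each letter is the source of the next. -/
def IsPath {n : ℕ} (w : Fin n → A) : Prop :=
  ∀ (k : ℕ) (hk : k + 1 < n), G.goal (w ⟨k, by omega⟩) = G.source (w ⟨k + 1, hk⟩)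

/-- `w` is a path starting at `q`. The empty path starts at every state. -/
def IsPathFrom {n : ℕ} (q : Q) (w : Fin n → A) : Prop :=
  G.IsPath w ∧ ∀ h : 0 < n, G.source (w ⟨0, h⟩) = q

/-- `w` is a path from `q` to `q'`. The empty path goes from each state to itself only. -/
def IsPathFromTo {n : ℕ} (q q' : Q) (w : Fin n → A) : Prop :=
  G.IsPathFrom q w ∧ (∀ h : 0 < n, G.goal (w ⟨n - 1, by omega⟩) = q') ∧ (n = 0 → q = q')

/-- Any state can be joined to any other one by a path. -/
def Connected : Prop :=
  ∀ q q' : Q, ∃ (n : ℕ) (w : Fin n → A), G.IsPathFromTo q q' w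

open Classical in
/-- The finite set of paths of length `n` starting at `q`. -/
noncomputable def pathsFrom [Fintype A] (n : ℕ) (q : Q) : Finset (Fin n → A) :=
  Finset.univ.filter fun w => G.IsPathFrom q w

/-- The greatest common divisor of the lengths of the closed paths at `q`. -/
noncomputable def period (q : Q) : ℕ :=
  Nat.setGcd {n | ∃ w : Fin n → A, G.IsPathFromTo q q w}

open Classical in
/-- The states that can be reached from `q` by a path whose length is congruent to `n` modulo
the period. -/
noncomputable def cyclicClass [Fintype Q] (q : Q) (n : ℕ) : Finset Q :=
  Finset.univ.filter fun q' =>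
    ∃ (m : ℕ) (w : Fin m → A), m ≡ n [MOD G.period q] ∧ G.IsPathFromTo q q' w

/-- The vector of `ℝ^A` whose `a`-th coordinate is the number of occurrences of the letter `a`
in the word `w`. -/
noncomputable def letterCount [DecidableEq A] {n : ℕ} (w : Fin n → A) : EuclideanSpace ℝ A :=
  WithLp.toLp 2 fun a => ((Finset.univ.filter fun k => w k = a).card : ℝ)

/-- The transfer operator `(L_θ f)(q) = ∑ e^{-θ(a)} f(γ(a))`, the sum being over the arrows `a`
with source `q`. -/
noncomputable def transfer [DecidableEq Q] [Fintype A] (θ : EuclideanSpace ℝ A) :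
    (Q → ℝ) →ₗ[ℝ] (Q → ℝ) where
  toFun f q := ∑ a with G.source a = q, Real.exp (-θ a) * f (G.goal a)
  map_add' f g := by
    ext q
    simp [mul_add, Finset.sum_add_distrib]
  map_smul' c f := by
    ext q
    simp [Finset.mul_sum, mul_left_comm]

/-- The spectral radius `λ(θ)` of the transfer operator: the largest modulus of its complex
eigenvalues. -/
noncomputable def lam [Fintype Q] [DecidableEq Q] [Fintype A] (θ : EuclideanSpace ℝ A) : ℝ :=
  (spectralRadius ℂ ((LinearMap.toMatrix' (G.transfer θ)).map ((↑) : ℝ → ℂ))).toReal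

/-- `f` and `φ` are the positive eigenvectors, for the eigenvalue `λ(θ)`, of the transfer operator
and of its adjoint, normalized by `⟨φ, 1⟩ = 1` and `⟨φ, f⟩ = 1`. -/
structure IsPerronPair [Fintype Q] [DecidableEq Q] [Fintype A] (θ : EuclideanSpace ℝ A)
    (φ f : Q → ℝ) : Prop where
  left_pos : ∀ q, 0 < φ q
  right_pos : ∀ q, 0 < f q
  right_eigen : G.transfer θ f = G.lam θ • f
  left_eigen : ∀ g : Q → ℝ, φ ⬝ᵥ G.transfer θ g = (G.lam θ • φ) ⬝ᵥ g
  left_normalized : φ ⬝ᵥ 1 = 1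
  normalized : φ ⬝ᵥ f = 1

/-- The drift `x_θ = -d_θ log λ`, the dual of `ℝ^A` being identified with `ℝ^A` through the standard
inner product. -/
noncomputable def drift [Fintype Q] [DecidableEq Q] [Fintype A] (θ : EuclideanSpace ℝ A) :
    EuclideanSpace ℝ A :=
  -gradient (fun ξ => Real.log (G.lam ξ)) θ

/-- The map `∇ : ℝ^Q → ℝ^A`, `(∇ f)(a) = f(γ(a)) - f(σ(a))`. -/
noncomputable def grad : (Q → ℝ) →ₗ[ℝ] EuclideanSpace ℝ A where
  toFun f := WithLp.toLp 2 fun a => f (G.goal a) - f (G.source a)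
  map_add' f g := by
    ext a
    simp only [Pi.add_apply, PiLp.add_apply]
    ring
  map_smul' c f := by
    ext a
    simp only [Pi.smul_apply, PiLp.smul_apply, smul_eq_mul, RingHom.id_apply]
    ring

/-- The orthogonal complement `E₀` of `ℝ1 + ∇(ℝ^Q)` in `ℝ^A`. -/
noncomputable def balancedSpace [Fintype A] : Submodule ℝ (EuclideanSpace ℝ A) :=
  (Submodule.span ℝ {WithLp.toLp 2 fun _ => (1 : ℝ)} ⊔ LinearMap.range G.grad)ᗮ

end ArrowGraph

namespace QuadraticForm

variable {H : Type*} [NormedAddCommGroup H] [NormedSpace ℝ H]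

/-- `b` is an orthonormal basis of the Euclidean space `(H, χ)`. -/
def IsOrthonormalBasis {ι : Type*} [DecidableEq ι] (χ : QuadraticForm ℝ H)
    (b : Module.Basis ι ℝ H) : Prop :=
  ∀ i j, QuadraticMap.associated (R := ℝ) χ (b i) (b j) = if i = j then 1 else 0

variable [FiniteDimensional ℝ H]

theorem exists_isOrthonormalBasis (χ : QuadraticForm ℝ H) (hχ : χ.PosDef) :
    ∃ b : Module.Basis (Fin (Module.finrank ℝ H)) ℝ H, IsOrthonormalBasis χ b := by
  obtain ⟨v, hv⟩ := LinearMap.BilinForm.exists_orthogonal_basis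
    (B := QuadraticMap.associated (R := ℝ) χ) ⟨QuadraticMap.associated_isSymm ℝ χ⟩
  have hpos : ∀ i, 0 < χ (v i) := fun i => hχ _ (v.ne_zero i)
  refine ⟨v.isUnitSMul (w := fun i => (√(χ (v i)))⁻¹)
    (fun i => (inv_ne_zero (Real.sqrt_pos.2 (hpos i)).ne').isUnit), fun i j => ?_⟩
  simp only [Module.Basis.isUnitSMul_apply, map_smul, LinearMap.smul_apply, smul_eq_mul]
  split_ifs with h
  · subst h
    rw [QuadraticMap.associated_eq_self_apply, ← mul_assoc, ← mul_inv,
      Real.mul_self_sqrt (hpos i).le, inv_mul_cancel₀ (hpos i).ne']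
  · have : QuadraticMap.associated (R := ℝ) χ (v i) (v j) = 0 := hv h
    rw [this]
    simp

variable [MeasurableSpace H] [BorelSpace H]

open Classical in
/-- The Lebesgue measure of the Euclidean space `(H, χ)`, for `χ` positive definite: the Haar
measure giving mass one to the unit hypercubes of `(H, χ)`
(see `lebesgue_parallelepiped_eq_one`). -/
noncomputable def lebesgue (χ : QuadraticForm ℝ H) : Measure H :=
  if h : ∃ b : Module.Basis (Fin (Module.finrank ℝ H)) ℝ H, IsOrthonormalBasis χ b then
    h.choose.addHaar
  else 0

theorem lebesgue_eq_addHaar (χ : QuadraticForm ℝ H)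
    (b : Module.Basis (Fin (Module.finrank ℝ H)) ℝ H) (hb : IsOrthonormalBasis χ b) :
    lebesgue χ = b.addHaar := by
  have h : ∃ b : Module.Basis (Fin (Module.finrank ℝ H)) ℝ H, IsOrthonormalBasis χ b := ⟨b, hb⟩
  rw [lebesgue, dif_pos h]
  obtain ⟨c, hc, hcc⟩ : ∃ c, IsOrthonormalBasis χ c ∧ h.choose = c := ⟨_, h.choose_spec, rfl⟩
  rw [hcc]
  set P : Matrix _ _ ℝ := c.toMatrix b with hP
  have hPP : P.transpose * P = 1 := by
    ext i j
    have h1 := hb i j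
    rw [← c.sum_toMatrix_smul_self b i, ← c.sum_toMatrix_smul_self b j] at h1
    simp only [map_sum, map_smul, LinearMap.sum_apply, LinearMap.smul_apply, smul_eq_mul,
      hc _ _] at h1
    simp only [mul_ite, mul_one, mul_zero, Finset.sum_ite_eq',
      Finset.mem_univ, if_true] at h1
    rw [Matrix.mul_apply, Matrix.one_apply]
    simp only [Matrix.transpose_apply]
    rw [← h1]
    exact Finset.sum_congr rfl fun k _ => mul_comm _ _
  have hdet : |P.det| = 1 := by
    have := congrArg Matrix.det hPP
    rw [Matrix.det_mul, Matrix.det_transpose, Matrix.det_one] at this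
    rcases mul_self_eq_one_iff.1 this with h | h <;> simp [h]
  refine ((Module.Basis.addHaar_eq_iff b c.addHaar).2 ?_).symm
  rw [Module.Basis.coe_parallelepiped, Measure.addHaar_parallelepiped, Module.Basis.det_apply,
    ← hP, hdet, ENNReal.ofReal_one]

theorem lebesgue_parallelepiped_eq_one (χ : QuadraticForm ℝ H)
    (b : Module.Basis (Fin (Module.finrank ℝ H)) ℝ H) (hb : IsOrthonormalBasis χ b) :
    lebesgue χ (parallelepiped b) = 1 := by
  rw [lebesgue_eq_addHaar χ b hb, Module.Basis.addHaar_self]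

end QuadraticForm

/-! Since `λ(θ) = 1`, Perron-Frobenius theory gives positive eigenvectors `f` and `φ` of the
transfer operator and its adjoint. The Doob transform `p(a) = e^{-θ(a)} f(γ(a)) / f(σ(a))` is then a
Markov chain charging every arrow, with stationary law `π = φ f`. A weighted sum over paths of
length `n` from `q` equals `f(q)` times the expectation, for this chain, of the summand divided by
the value of `f` at the final state (`sum_pathsFrom_eq_walkOp_pow`). Everything becomes a statement
about an additive functional of a finite Markov chain.

The basic tool is the Poisson equation (`IsMarkov.exists_corrector`): adding a gradient to a
function of the arrows makes all its conditional means equal. Used as a perturbation of `f` between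
the two Collatz-Wielandt bounds, it gives `λ(θ + k) = 1 - ⟨x, k⟩ + O(‖k‖²)`, where `x` is the vector
of stationary arrow frequencies; so `λ` is differentiable and the drift is `x`. Applied to the
centered increments, it yields a martingale with bounded increments `H t`; linear growth of its
second moment proves the law of large numbers.

For the central limit theorem, a second corrector makes the conditional variances constant. The
corrected exponential at frequency `s t` is an approximate eigenfunction of the walk operator, with
eigenvalue `exp(-s²τ(t)/2)` up to `o(s²)`, where `τ(t)` is the stationary mean of `(H t)²`.
Iterating `n` times with `s = 1/√n` gives convergence of characteristic functions, and Lévy's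
theorem concludes. The form `τ` vanishes exactly on the orthogonal of `E₀`, so the limit is a
Gaussian measure on `E₀`; its density involves the form `χ` dual to `τ`.

The factor `1/f(final state)` is decoupled from the position by isolating the last `k` steps: they
bring the state to equilibrium in its cyclic class (`IsMarkov.tendsto_markovOp_pow`) but move the
rescaled position only by `O(k/√n)`. The resulting mean of `1/f` is the period times the `φ`-mass of
the class. -/

set_option linter.unusedSectionVars false

/-! ### Paths, reachability and first-arrow decompositions. -/

namespace ArrowGraph

variable {Q A : Type*} (G : ArrowGraph Q A)

/-- There is a path of length `n` from `q` to `q'`. -/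
def Reach (n : ℕ) (q q' : Q) : Prop :=
  ∃ w : Fin n → A, G.IsPathFromTo q q' w

theorem reach_zero {q q' : Q} : G.Reach 0 q q' ↔ q = q' := by
  constructor
  · rintro ⟨w, -, -, h⟩
    exact h rfl
  · rintro rfl
    exact ⟨Fin.elim0, ⟨fun k hk => absurd hk (by omega), fun h => absurd h (by omega)⟩,
      fun h => absurd h (by omega), fun _ => rfl⟩

theorem isPathFrom_cons {n : ℕ} {q : Q} {a : A} {w : Fin n → A} :
    G.IsPathFrom q (Fin.cons a w : Fin (n + 1) → A) ↔
      G.source a = q ∧ G.IsPathFrom (G.goal a) w := by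
  constructor
  · rintro ⟨h1, h2⟩
    refine ⟨h2 n.succ_pos, fun k hk => h1 (k + 1) (by omega), fun h => ?_⟩
    exact (h1 0 (by omega)).symm
  · rintro ⟨h1, h2, h3⟩
    refine ⟨fun k hk => ?_, fun _ => h1⟩
    cases k with
    | zero => exact (h3 (by omega)).symm
    | succ k => exact h2 k (by omega)

theorem reach_succ {n : ℕ} {q q' : Q} :
    G.Reach (n + 1) q q' ↔ ∃ a, G.source a = q ∧ G.Reach n (G.goal a) q' := by
  constructor
  · rintro ⟨w, h1, h2, -⟩
    rw [← Fin.cons_self_tail w, isPathFrom_cons] at h1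
    refine ⟨w 0, h1.1, Fin.tail w, h1.2, fun h => ?_, fun h => ?_⟩
    · rw [← h2 (by omega)]
      simp only [Fin.tail]
      congr 2
      ext
      simp
      omega
    · subst h
      exact h2 (by omega)
  · rintro ⟨a, rfl, w, h1, h2, h3⟩
    refine ⟨Fin.cons a w, G.isPathFrom_cons.2 ⟨rfl, h1⟩, fun _ => ?_, fun h => absurd h (by omega)⟩
    cases n with
    | zero => exact h3 rfl
    | succ n => exact h2 (by omega)

theorem reach_one (a : A) : G.Reach 1 (G.source a) (G.goal a) :=
  G.reach_succ.2 ⟨a, rfl, G.reach_zero.2 rfl⟩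

variable {G}

theorem Reach.trans {m n : ℕ} {q q' q'' : Q} (h : G.Reach m q q') (h' : G.Reach n q' q'') :
    G.Reach (m + n) q q'' := by
  induction m generalizing q with
  | zero =>
    rw [reach_zero] at h
    subst h
    simpa using h'
  | succ m ih =>
    obtain ⟨a, ha, h⟩ := G.reach_succ.1 h
    rw [add_right_comm]
    exact G.reach_succ.2 ⟨a, ha, ih h⟩

theorem Connected.exists_reach (hG : G.Connected) (q q' : Q) : ∃ n, G.Reach n q q' :=
  hG q q'

/-- A set of states that is nonempty and closed under following arrows contains all states. -/
theorem Connected.induction_on (hG : G.Connected) {S : Q → Prop} {q₀ : Q} (h₀ : S q₀)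
    (hS : ∀ a, S (G.source a) → S (G.goal a)) (q : Q) : S q := by
  obtain ⟨n, hn⟩ := hG.exists_reach q₀ q
  induction n generalizing q₀ with
  | zero =>
    rw [reach_zero] at hn
    exact hn ▸ h₀
  | succ n ih =>
    obtain ⟨a, rfl, h⟩ := G.reach_succ.1 hn
    exact ih (hS a h₀) h

variable (G)

/-- The graph with all arrows reversed. -/
def reverse : ArrowGraph Q A where
  source := G.goal
  goal := G.source

theorem Reach.reverse {G : ArrowGraph Q A} {n : ℕ} {q q' : Q} (h : G.Reach n q q') :
    G.reverse.Reach n q' q := by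
  induction n generalizing q with
  | zero => exact (reach_zero _).2 ((reach_zero _).1 h).symm
  | succ n ih =>
    obtain ⟨a, rfl, h'⟩ := G.reach_succ.1 h
    exact (ih h').trans (G.reverse.reach_one a)

theorem Connected.reverse {G : ArrowGraph Q A} (hG : G.Connected) : G.reverse.Connected :=
  fun q q' => let ⟨n, hn⟩ := hG.exists_reach q' q; ⟨n, hn.reverse⟩

theorem letterCount_cons [DecidableEq A] {n : ℕ} (a : A) (w : Fin n → A) :
    letterCount (Fin.cons a w : Fin (n + 1) → A) =
      EuclideanSpace.single a 1 + letterCount w := by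
  ext b
  simp only [letterCount, PiLp.add_apply, PiLp.single_apply, Fin.univ_succ,
    Finset.filter_cons, Finset.filter_map]
  split_ifs with h h' h'
  · simp [add_comm]
  · exact absurd h.symm (by simpa using h')
  · exact absurd h'.symm (by simpa using h)
  · simp

theorem letterCount_zero [DecidableEq A] (w : Fin 0 → A) : letterCount w = 0 := by
  ext b
  simp [letterCount]

variable [Fintype A]

theorem sum_pathsFrom_zero {M : Type*} [AddCommMonoid M] (q : Q) (F : (Fin 0 → A) → M) :
    ∑ w ∈ G.pathsFrom 0 q, F w = F Fin.elim0 := by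
  have h : G.pathsFrom 0 q = {Fin.elim0} := by
    ext w
    simp only [pathsFrom, Finset.mem_filter, Finset.mem_univ, true_and, Finset.mem_singleton]
    refine ⟨fun _ => Subsingleton.elim _ _, fun _ => ⟨fun k hk => absurd hk (by omega),
      fun h => absurd h (by omega)⟩⟩
  rw [h, Finset.sum_singleton]

/-- Splitting off the first arrow: this matches one application of the transfer operator and drives
every later induction on the length. -/
theorem sum_pathsFrom_succ [DecidableEq Q] {M : Type*} [AddCommMonoid M] (n : ℕ) (q : Q)
    (F : (Fin (n + 1) → A) → M) :
    ∑ w ∈ G.pathsFrom (n + 1) q, F w =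
      ∑ a with G.source a = q, ∑ w ∈ G.pathsFrom n (G.goal a), F (Fin.cons a w) := by
  classical
  simp only [pathsFrom, Finset.sum_filter]
  rw [← (Fin.consEquiv fun _ : Fin (n + 1) => A).sum_comp, Fintype.sum_prod_type]
  refine Finset.sum_congr rfl fun a _ => ?_
  split_ifs with h
  · refine Finset.sum_congr rfl fun w _ => ?_
    simp [Fin.consEquiv, isPathFrom_cons, h]
  · refine Finset.sum_eq_zero fun w _ => ?_
    simp [Fin.consEquiv, isPathFrom_cons, h]

end ArrowGraph

/-! ### Transfer operator: Collatz-Wielandt bounds and Perron-Frobenius theory. -/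

namespace ArrowGraph

variable {Q A : Type*} [Fintype Q] [DecidableEq Q] [Fintype A] (G : ArrowGraph Q A)
  (θ : EuclideanSpace ℝ A)

/-- The matrix of the transfer operator, with complex coefficients. -/
noncomputable def complexMatrix : Matrix Q Q ℂ :=
  (LinearMap.toMatrix' (G.transfer θ)).map ((↑) : ℝ → ℂ)

theorem transfer_apply (f : Q → ℝ) (q : Q) :
    G.transfer θ f q = ∑ a with G.source a = q, Real.exp (-θ a) * f (G.goal a) := rfl

theorem toMatrix'_transfer (q q' : Q) :
    LinearMap.toMatrix' (G.transfer θ) q q' =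
      ∑ a, if G.source a = q ∧ G.goal a = q' then Real.exp (-θ a) else 0 := by
  rw [LinearMap.toMatrix'_apply, transfer_apply, Finset.sum_filter]
  refine Finset.sum_congr rfl fun a _ => ?_
  by_cases h : G.source a = q <;> by_cases h' : G.goal a = q' <;> simp [h, h']

theorem transfer_nonneg {f : Q → ℝ} (hf : 0 ≤ f) : 0 ≤ G.transfer θ f := fun _ =>
  Finset.sum_nonneg fun _ _ => mul_nonneg (Real.exp_pos _).le (hf _)

theorem transfer_mono {f g : Q → ℝ} (h : f ≤ g) : G.transfer θ f ≤ G.transfer θ g := by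
  have := G.transfer_nonneg θ (sub_nonneg.2 h)
  rwa [map_sub, sub_nonneg] at this

theorem transfer_iterate_nonneg {f : Q → ℝ} (hf : 0 ≤ f) (n : ℕ) :
    0 ≤ (G.transfer θ ^ n) f := by
  induction n with
  | zero => simpa using hf
  | succ n ih =>
    rw [pow_succ', Module.End.mul_apply]
    exact G.transfer_nonneg θ ih

theorem complexMatrix_mulVec (v : Q → ℂ) (q : Q) :
    (G.complexMatrix θ).mulVec v q =
      ∑ a with G.source a = q, (Real.exp (-θ a) : ℂ) * v (G.goal a) := by
  simp only [Matrix.mulVec, dotProduct, complexMatrix, Matrix.map_apply, toMatrix'_transfer,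
    Complex.ofReal_sum, Finset.sum_mul]
  rw [Finset.sum_comm, Finset.sum_filter]
  refine Finset.sum_congr rfl fun a _ => ?_
  by_cases h : G.source a = q <;> simp [h, apply_ite, ite_mul]

/-- The coefficients are nonnegative, so this is the triangle inequality; it lets moduli of complex
eigenvectors be compared with positive functions. -/
theorem norm_complexMatrix_mulVec_le (v : Q → ℂ) (q : Q) :
    ‖(G.complexMatrix θ).mulVec v q‖ ≤ G.transfer θ (fun q => ‖v q‖) q := by
  rw [complexMatrix_mulVec, transfer_apply]
  refine (norm_sum_le _ _).trans (Finset.sum_le_sum fun a _ => ?_)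
  rw [norm_mul, Complex.norm_real, Real.norm_of_nonneg (Real.exp_pos _).le]

theorem complexMatrix_pow_mulVec (g : Q → ℝ) (n : ℕ) :
    (G.complexMatrix θ ^ n).mulVec (fun q => (g q : ℂ)) = fun q => ((G.transfer θ ^ n) g q : ℂ) := by
  induction n with
  | zero => simp
  | succ n ih =>
    rw [pow_succ', ← Matrix.mulVec_mulVec, ih, pow_succ']
    ext q
    rw [complexMatrix_mulVec, Module.End.mul_apply, transfer_apply]
    push_cast
    rfl

theorem exists_eigenvector_of_mem_spectrum {M : Matrix Q Q ℂ} {k : ℂ} (hk : k ∈ spectrum ℂ M) :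
    ∃ v : Q → ℂ, v ≠ 0 ∧ M.mulVec v = k • v := by
  rw [← Matrix.spectrum_toLin', ← Module.End.hasEigenvalue_iff_mem_spectrum] at hk
  obtain ⟨v, hv⟩ := hk.exists_hasEigenvector
  exact ⟨v, hv.2, by simpa using hv.apply_eq_smul⟩

attribute [local instance] Matrix.linftyOpNormedRing Matrix.linftyOpNormedAlgebra

theorem lam_eq : G.lam θ = (spectralRadius ℂ (G.complexMatrix θ)).toReal := rfl

/-- The point is finiteness, without which `toReal` in `lam` would lose information. -/
theorem spectralRadius_complexMatrix :
    spectralRadius ℂ (G.complexMatrix θ) = ENNReal.ofReal (G.lam θ) := by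
  rw [lam_eq, ENNReal.ofReal_toReal]
  have : CompleteSpace (Matrix Q Q ℂ) := FiniteDimensional.complete ℂ _
  cases isEmpty_or_nonempty Q
  · rw [spectrum.SpectralRadius.of_subsingleton]
    exact ENNReal.zero_ne_top
  · exact ((spectrum.spectralRadius_le_nnnorm _).trans_lt ENNReal.coe_lt_top).ne

/-- The upper Collatz-Wielandt bound. -/
theorem lam_le [Nonempty Q] {g : Q → ℝ} (hg : ∀ q, 0 < g q) {c : ℝ}
    (h : ∀ q, G.transfer θ g q ≤ c * g q) : G.lam θ ≤ c := by
  have hc : 0 ≤ c := by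
    obtain ⟨q⟩ := ‹Nonempty Q›
    have h1 : 0 ≤ c * g q := (G.transfer_nonneg θ (fun q => (hg q).le) q).trans (h q)
    exact nonneg_of_mul_nonneg_left h1 (hg q)
  rw [lam_eq]
  refine ENNReal.toReal_le_of_le_ofReal hc (iSup₂_le fun k hk => ?_)
  obtain ⟨v, hv0, hv⟩ := exists_eigenvector_of_mem_spectrum hk
  rw [← ENNReal.ofReal_coe_nnreal, coe_nnnorm]
  refine ENNReal.ofReal_le_ofReal ?_
  -- At a state where `‖v‖ / g` is largest, domination of `‖v‖` by `m • g` is an equality, which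
  -- turns the inequality for `g` into one for the eigenvalue.
  obtain ⟨q₀, hq₀⟩ := Finite.exists_max fun q => ‖v q‖ / g q
  set m := ‖v q₀‖ / g q₀ with hm
  have hle : ∀ q, ‖v q‖ ≤ m * g q := fun q => (div_le_iff₀ (hg q)).1 (hq₀ q)
  have hmpos : 0 < m := by
    obtain ⟨q, hq⟩ := Function.ne_iff.1 hv0
    exact (div_pos (norm_pos_iff.2 hq) (hg q)).trans_le (hq₀ q)
  have h1 : ‖k‖ * ‖v q₀‖ ≤ m * (c * g q₀) := by
    calc ‖k‖ * ‖v q₀‖ = ‖(G.complexMatrix θ).mulVec v q₀‖ := by rw [hv]; simp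
      _ ≤ _ := G.norm_complexMatrix_mulVec_le θ v q₀
      _ ≤ G.transfer θ (m • g) q₀ := G.transfer_mono θ (fun q => hle q) q₀
      _ = m * G.transfer θ g q₀ := by rw [map_smul]; rfl
      _ ≤ _ := mul_le_mul_of_nonneg_left (h q₀) hmpos.le
  have h2 : ‖v q₀‖ = m * g q₀ := by rw [hm, div_mul_cancel₀ _ (hg q₀).ne']
  rw [h2] at h1
  have h3 : 0 < m * g q₀ := mul_pos hmpos (hg q₀)
  refine le_of_mul_le_mul_right (a := m * g q₀) ?_ h3
  linarith

/-- The lower Collatz-Wielandt bound. -/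
theorem le_lam [Nonempty Q] {g : Q → ℝ} (hg : ∀ q, 0 < g q) {c : ℝ} (hc : 0 ≤ c)
    (h : ∀ q, c * g q ≤ G.transfer θ g q) : c ≤ G.lam θ := by
  have : CompleteSpace (Matrix Q Q ℂ) := FiniteDimensional.complete ℂ _
  have hpow : ∀ n : ℕ, c ^ n • g ≤ (G.transfer θ ^ n) g := by
    intro n
    induction n with
    | zero => simp
    | succ n ih =>
      rw [pow_succ' (G.transfer θ), Module.End.mul_apply]
      refine le_trans ?_ (G.transfer_mono θ ih)
      rw [map_smul, pow_succ, mul_smul]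
      exact fun q => mul_le_mul_of_nonneg_left (h q) (pow_nonneg hc n)
  obtain ⟨q₀⟩ := ‹Nonempty Q›
  -- `K` compares the sup norm of `g` with one of its values; its `n`-th root tends to `1` and
  -- disappears in the limit.
  set K : ℝ := ‖fun q => (g q : ℂ)‖ / g q₀ with hK
  have hK0 : 0 < K := by
    refine div_pos ((norm_pos_iff (a := fun q => (g q : ℂ))).2 fun h0 => ?_) (hg q₀)
    have := congrFun h0 q₀
    simp [(hg q₀).ne'] at this
  have hnorm : ∀ n : ℕ, c ^ n / K ≤ ‖G.complexMatrix θ ^ n‖ := by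
    intro n
    rw [hK, div_div_eq_mul_div, div_le_iff₀]
    · calc c ^ n * g q₀ ≤ (G.transfer θ ^ n) g q₀ := hpow n q₀
        _ ≤ ‖(fun q => ((G.transfer θ ^ n) g q : ℂ)) q₀‖ := by
          rw [Complex.norm_real]; exact le_abs_self _
        _ ≤ ‖(fun q => ((G.transfer θ ^ n) g q : ℂ))‖ :=
          norm_le_pi_norm (fun q => ((G.transfer θ ^ n) g q : ℂ)) q₀
        _ ≤ _ := by
          rw [← complexMatrix_pow_mulVec]
          exact Matrix.linfty_opNorm_mulVec _ _
    · exact (div_pos_iff_of_pos_right (hg q₀)).1 hK0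
  -- Gelfand's formula, for the operator norm attached to the sup norm on vectors.
  have hlim := spectrum.pow_norm_pow_one_div_tendsto_nhds_spectralRadius (G.complexMatrix θ)
  have hlim2 : Tendsto (fun n : ℕ => ENNReal.ofReal (c * K⁻¹ ^ (1 / n : ℝ))) atTop
      (𝓝 (ENNReal.ofReal (c * K⁻¹ ^ (0 : ℝ)))) := by
    refine (ENNReal.continuous_ofReal.tendsto _).comp (Tendsto.const_mul _ ?_)
    exact ((Real.continuousAt_const_rpow (inv_pos.2 hK0).ne').tendsto).comp
      tendsto_one_div_atTop_nhds_zero_nat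
  have := le_of_tendsto_of_tendsto hlim2 hlim (by
    filter_upwards [eventually_gt_atTop 0] with n hn
    refine ENNReal.ofReal_le_ofReal ?_
    calc c * K⁻¹ ^ (1 / n : ℝ) = (c ^ n / K) ^ (1 / n : ℝ) := by
          rw [div_eq_mul_inv (c ^ n), Real.mul_rpow (pow_nonneg hc n) (inv_pos.2 hK0).le, one_div,
            Real.pow_rpow_inv_natCast hc hn.ne']
      _ ≤ _ := Real.rpow_le_rpow (div_nonneg (pow_nonneg hc n) hK0.le) (hnorm n) (by positivity))
  rw [spectralRadius_complexMatrix, Real.rpow_zero, mul_one] at this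
  rcases le_or_gt 0 (G.lam θ) with h0 | h0
  · exact (ENNReal.ofReal_le_ofReal_iff h0).1 this
  · exact absurd h0 (not_lt.2 ENNReal.toReal_nonneg)

/-- Take the modulus of an eigenvector whose eigenvalue attains the spectral radius. -/
theorem exists_subinvariant [Nonempty Q] :
    ∃ g : Q → ℝ, 0 ≤ g ∧ g ≠ 0 ∧ G.lam θ • g ≤ G.transfer θ g := by
  have : CompleteSpace (Matrix Q Q ℂ) := FiniteDimensional.complete ℂ _
  obtain ⟨k, hk, hk'⟩ := spectrum.exists_nnnorm_eq_spectralRadius (G.complexMatrix θ)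
  obtain ⟨v, hv0, hv⟩ := exists_eigenvector_of_mem_spectrum hk
  refine ⟨fun q => ‖v q‖, fun q => norm_nonneg _, fun h => hv0 ?_, fun q => ?_⟩
  · ext q
    simpa using congrFun h q
  · refine le_trans (le_of_eq ?_) (G.norm_complexMatrix_mulVec_le θ v q)
    rw [hv, lam_eq, ← hk']
    simp

variable {G}

theorem transfer_pow_pos {n : ℕ} {q q' : Q} (h : G.Reach n q q') {d : Q → ℝ} (hd : 0 ≤ d)
    (hq' : 0 < d q') : 0 < (G.transfer θ ^ n) d q := by
  induction n generalizing q with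
  | zero =>
    rw [reach_zero] at h
    simpa [h] using hq'
  | succ n ih =>
    obtain ⟨a, rfl, h'⟩ := G.reach_succ.1 h
    rw [pow_succ', Module.End.mul_apply, transfer_apply]
    refine Finset.sum_pos' (fun b _ => mul_nonneg (Real.exp_pos _).le
      (G.transfer_iterate_nonneg θ hd n _)) ⟨a, by simp, mul_pos (Real.exp_pos _) (ih h')⟩

/-- For a periodic graph of period greater than one no single power is positivity improving; a sum
of powers up to the largest chosen connecting length is. -/
theorem Connected.exists_sum_transfer_pow_pos (hG : G.Connected) :
    ∃ N : ℕ, ∀ d : Q → ℝ, 0 ≤ d → d ≠ 0 →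
      ∀ q, 0 < (∑ n ∈ Finset.range N, G.transfer θ ^ n) d q := by
  choose n hn using hG.exists_reach
  refine ⟨(Finset.univ.sup fun u : Q × Q => n u.1 u.2) + 1, fun d hd hd0 q => ?_⟩
  obtain ⟨q', hq'⟩ := Function.ne_iff.1 hd0
  rw [LinearMap.sum_apply, Finset.sum_apply]
  refine Finset.sum_pos' (fun i _ => G.transfer_iterate_nonneg θ hd i q)
    ⟨n q q', ?_, transfer_pow_pos θ (hn q q') hd (lt_of_le_of_ne (hd q') hq'.symm)⟩
  rw [Finset.mem_range, Nat.lt_succ_iff]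
  exact Finset.le_sup (f := fun u : Q × Q => n u.1 u.2) (Finset.mem_univ (q, q'))

/-- The Perron-Frobenius theorem: existence of a positive eigenvector. -/
theorem Connected.exists_pos_eigenvector (hG : G.Connected) [Nonempty Q] (hθ : G.lam θ = 1) :
    ∃ f : Q → ℝ, (∀ q, 0 < f q) ∧ G.transfer θ f = f := by
  obtain ⟨g, hg, hg0, hle⟩ := G.exists_subinvariant θ
  rw [hθ, one_smul] at hle
  obtain ⟨N, hN⟩ := hG.exists_sum_transfer_pow_pos θ
  have heq : G.transfer θ g = g := by
    by_contra hne
    -- `S` commutes with the transfer operator and makes the nonzero defect positive everywhere.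
    -- Thus `S g` is strictly increased at every state, by a uniform ratio above `1`, which the
    -- lower Collatz-Wielandt bound forbids.
    set S := ∑ n ∈ Finset.range N, G.transfer θ ^ n with hS
    have hd := hN (G.transfer θ g - g) (sub_nonneg.2 hle) (sub_ne_zero.2 hne)
    have hy := hN g hg hg0
    have hcomm : S (G.transfer θ g) = G.transfer θ (S g) := by
      rw [← Module.End.mul_apply, ← Module.End.mul_apply, hS, Finset.sum_mul, Finset.mul_sum]
      simp only [← pow_succ, ← pow_succ']
    obtain ⟨q₀, hq₀⟩ := Finite.exists_min fun q => G.transfer θ (S g) q / S g q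
    have hlt : 1 < G.transfer θ (S g) q₀ / S g q₀ := by
      rw [one_lt_div (hy q₀)]
      have := hd q₀
      rw [map_sub, hcomm, Pi.sub_apply, sub_pos] at this
      exact this
    have := G.le_lam θ hy (zero_le_one.trans hlt.le) fun q => (le_div_iff₀ (hy q)).1 (hq₀ q)
    linarith
  refine ⟨g, fun q => ?_, heq⟩
  -- By invariance the sum of the first `N` powers maps `g` to `N g`, which is therefore positive
  -- everywhere.
  have hpow : ∀ n : ℕ, (G.transfer θ ^ n) g = g := by
    intro n
    induction n with
    | zero => simp
    | succ n ih => rw [pow_succ, Module.End.mul_apply, heq, ih]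
  have := hN g hg hg0 q
  rw [LinearMap.sum_apply] at this
  simp only [hpow, Finset.sum_const, Finset.card_range, Pi.smul_apply, nsmul_eq_mul] at this
  exact pos_of_mul_pos_right this N.cast_nonneg

variable (G)

theorem dotProduct_transfer (φ g : Q → ℝ) :
    φ ⬝ᵥ G.transfer θ g = ∑ a, φ (G.source a) * Real.exp (-θ a) * g (G.goal a) := by
  simp only [dotProduct, transfer_apply, Finset.mul_sum]
  rw [← Finset.sum_fiberwise Finset.univ G.source]
  refine Finset.sum_congr rfl fun q _ => Finset.sum_congr rfl fun a ha => ?_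
  rw [(Finset.mem_filter.1 ha).2, mul_assoc]

theorem dotProduct_transfer_reverse (φ g : Q → ℝ) :
    G.reverse.transfer θ φ ⬝ᵥ g = φ ⬝ᵥ G.transfer θ g := by
  rw [dotProduct_comm, dotProduct_transfer, dotProduct_transfer]
  refine Finset.sum_congr rfl fun a _ => ?_
  simp only [reverse]
  ring

/-- Reversing the arrows transposes the matrix, which preserves the spectrum; hence left
eigenvectors come from the existence result for the reversed graph. -/
theorem lam_reverse : G.reverse.lam θ = G.lam θ := by
  have h : G.reverse.complexMatrix θ = (G.complexMatrix θ).transpose := by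
    ext q q'
    simp only [complexMatrix, Matrix.map_apply, Matrix.transpose_apply, toMatrix'_transfer,
      reverse, and_comm]
  have hs : ∀ M : Matrix Q Q ℂ, spectrum ℂ M.transpose = spectrum ℂ M := by
    intro M
    ext k
    simp only [spectrum.mem_iff]
    rw [← Matrix.isUnit_transpose (A := algebraMap ℂ (Matrix Q Q ℂ) k - M), Matrix.transpose_sub,
      Matrix.algebraMap_eq_diagonal, Matrix.diagonal_transpose]
  rw [lam_eq, lam_eq, h, spectralRadius, hs]
  rfl

end ArrowGraph

/-! ### Markov chains on the graph, the Poisson equation and the Doob transform. -/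

namespace ArrowGraph

variable {Q A : Type*} [Fintype Q] [DecidableEq Q] [Fintype A] {G : ArrowGraph Q A}

theorem sum_mul_sum_source {R : Type*} [NonUnitalNonAssocSemiring R] (G : ArrowGraph Q A)
    (π : Q → R) (F : A → R) :
    ∑ q, π q * ∑ a with G.source a = q, F a = ∑ a, π (G.source a) * F a := by
  simp only [Finset.mul_sum]
  rw [← Finset.sum_fiberwise Finset.univ G.source]
  refine Finset.sum_congr rfl fun q _ => Finset.sum_congr rfl fun a ha => ?_
  rw [(Finset.mem_filter.1 ha).2]

/-- A function that is harmonic for a Markov chain charging all arrows of a connected graph is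
constant. -/
theorem Connected.eq_of_harmonic (hG : G.Connected) {p : A → ℝ} (hp : ∀ a, 0 < p a)
    (hp1 : ∀ q, ∑ a with G.source a = q, p a = 1) {u : Q → ℝ}
    (hu : ∀ q, ∑ a with G.source a = q, p a * u (G.goal a) = u q) (q q' : Q) : u q = u q' := by
  have : Nonempty Q := ⟨q⟩
  -- Maximum principle: where the maximum is attained, a mean with positive weights forces it at all
  -- successors.
  obtain ⟨q₀, hq₀⟩ := Finite.exists_max u
  have key : ∀ q, u q = u q₀ := by
    refine hG.induction_on (q₀ := q₀) rfl fun a ha => ?_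
    have h0 : ∑ b with G.source b = G.source a, p b * (u q₀ - u (G.goal b)) = 0 := by
      simp only [mul_sub, Finset.sum_sub_distrib, hu, ← Finset.sum_mul, hp1, ha]
      ring
    have h1 := (Finset.sum_eq_zero_iff_of_nonneg fun b _ =>
      mul_nonneg (hp b).le (sub_nonneg.2 (hq₀ (G.goal b)))).1 h0 a (by simp)
    rcases mul_eq_zero.1 h1 with h | h
    · exact absurd h (hp a).ne'
    · linarith
  rw [key q, key q']

/-- Transition probabilities `p` of a Markov chain moving along the arrows of the graph, each of
which has positive probability, with a stationary probability `π`. -/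
structure IsMarkov (G : ArrowGraph Q A) (p : A → ℝ) (π : Q → ℝ) : Prop where
  pos : ∀ a, 0 < p a
  sum_eq_one : ∀ q, ∑ a with G.source a = q, p a = 1
  stat_pos : ∀ q, 0 < π q
  stat_sum : ∑ q, π q = 1
  stationary : ∀ g : Q → ℝ, ∑ a, π (G.source a) * (p a * g (G.goal a)) = ∑ q, π q * g q

namespace IsMarkov

variable {p : A → ℝ} {π : Q → ℝ}

theorem mean_const (hM : G.IsMarkov p π) (c : ℝ) (q : Q) :
    ∑ a with G.source a = q, p a * c = c := by
  rw [← Finset.sum_mul, hM.sum_eq_one, one_mul]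

theorem sum_stat_mul_const (hM : G.IsMarkov p π) (c : ℝ) : ∑ q, π q * c = c := by
  rw [← Finset.sum_mul, hM.stat_sum, one_mul]

theorem sum_sub_stationary (hM : G.IsMarkov p π) (u : Q → ℝ) :
    ∑ a, π (G.source a) * (p a * (u (G.goal a) - u (G.source a))) = 0 := by
  have h : ∑ a, π (G.source a) * (p a * u (G.source a)) = ∑ q, π q * u q := by
    rw [← sum_mul_sum_source]
    refine Finset.sum_congr rfl fun q _ => ?_
    congr 1
    rw [← hM.mean_const (u q) q]
    exact Finset.sum_congr rfl fun a ha => by rw [(Finset.mem_filter.1 ha).2]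
  simp only [mul_sub, Finset.sum_sub_distrib, hM.stationary, h, sub_self]

/-- Solution of the Poisson equation: up to the gradient of a corrector `K h`, the
conditional means of `h` are constant. -/
theorem exists_corrector (hM : G.IsMarkov p π) (hG : G.Connected) :
    ∃ K : (A → ℝ) →ₗ[ℝ] (Q → ℝ), ∀ h q,
      ∑ a with G.source a = q, p a * (h a + (K h (G.goal a) - K h (G.source a))) =
        ∑ a, π (G.source a) * (p a * h a) := by
  -- `I - P` plus the rank-one map `u ↦ π(u) 1`. The added term removes the constants from the
  -- kernel, so `B` is invertible.
  let B : (Q → ℝ) →ₗ[ℝ] (Q → ℝ) :=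
    { toFun u q := u q - ∑ a with G.source a = q, p a * u (G.goal a) + ∑ q', π q' * u q'
      map_add' u v := by
        ext q
        simp only [Pi.add_apply, mul_add, Finset.sum_add_distrib]
        ring
      map_smul' c u := by
        ext q
        simp only [Pi.smul_apply, smul_eq_mul, RingHom.id_apply, mul_add, mul_sub, Finset.mul_sum,
          mul_left_comm c] }
  have hB : ∀ u q, B u q =
    u q - ∑ a with G.source a = q, p a * u (G.goal a) + ∑ q', π q' * u q' := fun _ _ => rfl
  have hπB : ∀ u, ∑ q, π q * B u q = ∑ q, π q * u q := by
    intro u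
    simp only [hB, mul_add, mul_sub, Finset.sum_add_distrib, Finset.sum_sub_distrib,
      sum_mul_sum_source, hM.stationary, hM.sum_stat_mul_const]
    ring
  have hinj : Function.Injective B := by
    rw [← LinearMap.ker_eq_bot, LinearMap.ker_eq_bot']
    intro u hu
    have h0 : ∑ q, π q * u q = 0 := by rw [← hπB, hu]; simp
    have hharm : ∀ q, ∑ a with G.source a = q, p a * u (G.goal a) = u q := by
      intro q
      have := hB u q
      rw [hu, h0, Pi.zero_apply] at this
      linarith
    ext q
    have hc := hG.eq_of_harmonic hM.pos hM.sum_eq_one hharm q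
    rw [Finset.sum_congr rfl fun q' _ => by rw [← hc q'], hM.sum_stat_mul_const] at h0
    exact h0
  let e := LinearEquiv.ofInjectiveEndo B hinj
  let m : (A → ℝ) →ₗ[ℝ] (Q → ℝ) :=
    { toFun h q := ∑ a with G.source a = q, p a * h a - ∑ a, π (G.source a) * (p a * h a)
      map_add' h k := by
        ext q
        simp only [Pi.add_apply, mul_add, Finset.sum_add_distrib]
        ring
      map_smul' c h := by
        ext q
        simp only [Pi.smul_apply, smul_eq_mul, RingHom.id_apply, mul_sub, Finset.mul_sum,
          mul_left_comm c] }
  have hm : ∀ h q, m h q =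
    ∑ a with G.source a = q, p a * h a - ∑ a, π (G.source a) * (p a * h a) := fun _ _ => rfl
  refine ⟨e.symm.toLinearMap ∘ₗ m, fun h q => ?_⟩
  set u := (e.symm.toLinearMap ∘ₗ m) h with hu
  have hBu : B u = m h := e.apply_symm_apply (m h)
  -- `B` preserves `π`-means and `m h` has mean zero, so the rank-one term vanishes on `u` and `B u
  -- = m h` is the Poisson equation itself.
  have h0 : ∑ q, π q * u q = 0 := by
    rw [← hπB, hBu]
    simp only [hm, mul_sub, Finset.sum_sub_distrib, sum_mul_sum_source, hM.sum_stat_mul_const,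
      sub_self]
  have h1 := congrFun hBu q
  rw [hB, hm, h0] at h1
  have h2 : ∑ a with G.source a = q, p a * u (G.source a) = u q := by
    rw [← hM.mean_const (u q) q]
    exact Finset.sum_congr rfl fun a ha => by rw [(Finset.mem_filter.1 ha).2]
  simp only [mul_add, mul_sub, Finset.sum_add_distrib, Finset.sum_sub_distrib, h2]
  linarith

end IsMarkov

variable {θ : EuclideanSpace ℝ A} {φ f : Q → ℝ}

/-- The transition probabilities of the Markov chain associated with a positive eigenvector. -/
noncomputable def transition (G : ArrowGraph Q A) (θ : EuclideanSpace ℝ A) (f : Q → ℝ) (a : A) :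
    ℝ :=
  Real.exp (-θ a) * f (G.goal a) / f (G.source a)

theorem transition_pos (hf : ∀ q, 0 < f q) (a : A) : 0 < G.transition θ f a :=
  div_pos (mul_pos (Real.exp_pos _) (hf _)) (hf _)

theorem sum_transition (f g : Q → ℝ) (q : Q) :
    ∑ a with G.source a = q, G.transition θ f a * g (G.goal a) =
      G.transfer θ (f * g) q / f q := by
  rw [transfer_apply, Finset.sum_div]
  refine Finset.sum_congr rfl fun a ha => ?_
  rw [transition, (Finset.mem_filter.1 ha).2, Pi.mul_apply]
  ring

theorem sum_transition_eq_one (hf : ∀ q, 0 < f q) (hfe : G.transfer θ f = f) (q : Q) :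
    ∑ a with G.source a = q, G.transition θ f a = 1 := by
  have := sum_transition (G := G) (θ := θ) f 1 q
  simpa [hfe, (hf q).ne'] using this

/-- The Doob transform: the equation for `f` normalizes the probabilities, and the equation for `φ`,
tested on `f * g`, is the stationarity of `φ * f`. -/
theorem isMarkov_transition (hf : ∀ q, 0 < f q) (hfe : G.transfer θ f = f) (hφ : ∀ q, 0 < φ q)
    (hφe : ∀ g, φ ⬝ᵥ G.transfer θ g = φ ⬝ᵥ g) (hφf : φ ⬝ᵥ f = 1) :
    G.IsMarkov (G.transition θ f) (φ * f) where
  pos := transition_pos hf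
  sum_eq_one := sum_transition_eq_one hf hfe
  stat_pos q := mul_pos (hφ q) (hf q)
  stat_sum := hφf
  stationary g := by
    rw [← sum_mul_sum_source]
    have h := hφe (f * g)
    simp only [dotProduct, Pi.mul_apply] at h
    simp only [sum_transition, Pi.mul_apply, mul_assoc, ← h]
    refine Finset.sum_congr rfl fun q _ => ?_
    rw [mul_div_cancel₀ _ (hf q).ne']

/-- The quotient of an invariant function by `f` is harmonic for the Doob transform, hence constant.
-/
theorem Connected.exists_smul_eq_of_eigenvector (hG : G.Connected) [Nonempty Q] {f' : Q → ℝ}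
    (hf : ∀ q, 0 < f q) (hfe : G.transfer θ f = f) (hfe' : G.transfer θ f' = f') :
    ∃ c : ℝ, f' = c • f := by
  have hff : f * (f' / f) = f' := by
    ext q
    exact mul_div_cancel₀ _ (hf q).ne'
  have h := hG.eq_of_harmonic (transition_pos (θ := θ) hf) (sum_transition_eq_one hf hfe)
    (u := f' / f) fun q => by
      rw [sum_transition, hff, hfe']
      rfl
  obtain ⟨q₀⟩ := ‹Nonempty Q›
  refine ⟨(f' / f) q₀, ?_⟩
  ext q
  rw [Pi.smul_apply, smul_eq_mul, ← h q, Pi.div_apply, div_mul_cancel₀ _ (hf q).ne']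

theorem reverse_transfer_eq_iff {φ : Q → ℝ} : G.reverse.transfer θ φ = φ ↔
    ∀ g, φ ⬝ᵥ G.transfer θ g = φ ⬝ᵥ g := by
  simp only [← dotProduct_transfer_reverse]
  exact ⟨fun h g => by rw [h], fun h => dotProduct_eq _ _ h⟩

/-- Existence and uniqueness of the normalized pair of Perron eigenvectors. -/
theorem Connected.existsUnique_isPerronPair (hG : G.Connected) [Nonempty Q] (hθ : G.lam θ = 1) :
    ∃! u : (Q → ℝ) × (Q → ℝ), G.IsPerronPair θ u.1 u.2 := by
  obtain ⟨f, hf, hfe⟩ := hG.exists_pos_eigenvector θ hθ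
  obtain ⟨φ, hφ, hφe⟩ := hG.reverse.exists_pos_eigenvector θ ((lam_reverse G θ).trans hθ)
  have hs : 0 < φ ⬝ᵥ (1 : Q → ℝ) :=
    Finset.sum_pos (fun q _ => by simpa using hφ q) Finset.univ_nonempty
  have ht : 0 < φ ⬝ᵥ f :=
    Finset.sum_pos (fun q _ => mul_pos (hφ q) (hf q)) Finset.univ_nonempty
  refine ⟨((φ ⬝ᵥ 1)⁻¹ • φ, ((φ ⬝ᵥ 1) / (φ ⬝ᵥ f)) • f), ?_, ?_⟩
  · refine ⟨fun q => mul_pos (inv_pos.2 hs) (hφ q), fun q => mul_pos (div_pos hs ht) (hf q), ?_,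
      fun g => ?_, ?_, ?_⟩
    · rw [map_smul, hfe, hθ, one_smul]
    · rw [hθ, one_smul, smul_dotProduct, smul_dotProduct, reverse_transfer_eq_iff.1 hφe]
    · rw [smul_dotProduct, smul_eq_mul, inv_mul_cancel₀ hs.ne']
    · rw [smul_dotProduct, dotProduct_smul, smul_eq_mul, smul_eq_mul]
      field_simp
  · rintro ⟨φ', f'⟩ ⟨hφ', hf', hfe', hφe', hn, hn'⟩
    simp only at hφ' hf' hfe' hφe' hn hn'
    rw [hθ, one_smul] at hfe' hφe'
    obtain ⟨c, rfl⟩ := hG.exists_smul_eq_of_eigenvector hf hfe hfe'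
    obtain ⟨d, rfl⟩ := hG.reverse.exists_smul_eq_of_eigenvector hφ hφe
      (reverse_transfer_eq_iff.2 hφe')
    rw [smul_dotProduct, smul_eq_mul] at hn
    rw [smul_dotProduct, dotProduct_smul, smul_eq_mul, smul_eq_mul] at hn'
    have hd : d = (φ ⬝ᵥ 1)⁻¹ := eq_inv_of_mul_eq_one_left hn
    have hc : c = (φ ⬝ᵥ 1) / (φ ⬝ᵥ f) := by
      rw [hd] at hn'
      field_simp at hn' ⊢
      linarith
    rw [hc, hd]

end ArrowGraph

/-! ### Differentiability of the spectral radius and the drift. -/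

namespace ArrowGraph

variable {Q A : Type*} [Fintype Q] [DecidableEq Q] [Fintype A] {G : ArrowGraph Q A}
  {θ : EuclideanSpace ℝ A} {π f : Q → ℝ} {p : A → ℝ}

/-- The stationary frequencies of the arrows. -/
noncomputable def frequency (G : ArrowGraph Q A) (p : A → ℝ) (π : Q → ℝ) : EuclideanSpace ℝ A :=
  WithLp.toLp 2 fun a => π (G.source a) * p a

theorem inner_frequency (k : EuclideanSpace ℝ A) :
    ⟪G.frequency p π, k⟫ = ∑ a, π (G.source a) * (p a * k a) := by
  rw [PiLp.inner_apply]
  refine Finset.sum_congr rfl fun a _ => ?_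
  simp only [frequency, RCLike.inner_apply, conj_trivial]
  ring

theorem lam_nonneg (θ : EuclideanSpace ℝ A) : 0 ≤ G.lam θ := ENNReal.toReal_nonneg

theorem transfer_add_exp (hf : ∀ q, 0 < f q) (k : EuclideanSpace ℝ A) (u : Q → ℝ) (q : Q) :
    G.transfer (θ + k) (fun q => f q * Real.exp (u q)) q =
      (∑ a with G.source a = q, G.transition θ f a *
        Real.exp (-k a + (u (G.goal a) - u (G.source a)))) * (f q * Real.exp (u q)) := by
  rw [transfer_apply, Finset.sum_mul]
  refine Finset.sum_congr rfl fun a ha => ?_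
  rw [transition, (Finset.mem_filter.1 ha).2, PiLp.add_apply, neg_add, Real.exp_add, Real.exp_add,
    Real.exp_sub]
  have := (hf q).ne'
  field_simp

/-- The test function `f e^u`, with `u` the corrector of `-k`, makes the first-order term of the
ratio `L_{θ+k}(f e^u) / (f e^u)` the same at all states. Only a quadratic error remains, and both
Collatz-Wielandt bounds apply. -/
theorem Connected.abs_lam_add_sub_le (hG : G.Connected) [Nonempty Q] (hf : ∀ q, 0 < f q)
    (hM : G.IsMarkov (G.transition θ f) π) :
    ∃ C : ℝ, 0 ≤ C ∧ ∀ k : EuclideanSpace ℝ A, C * ‖k‖ ≤ 1 →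
      |G.lam (θ + k) - (1 - ⟪G.frequency (G.transition θ f) π, k⟫)| ≤ C ^ 2 * ‖k‖ ^ 2 := by
  obtain ⟨K, hK⟩ := hM.exists_corrector hG
  -- The corrected exponent is linear in `k`, so its operator norm serves as the constant.
  let Z : EuclideanSpace ℝ A →ₗ[ℝ] (A → ℝ) :=
    { toFun k a := (-k.ofLp) a + (K (-k.ofLp) (G.goal a) - K (-k.ofLp) (G.source a))
      map_add' k l := by
        ext a
        simp only [WithLp.ofLp_add, neg_add, map_add, Pi.add_apply, Pi.neg_apply]
        ring
      map_smul' c k := by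
        ext a
        simp only [WithLp.ofLp_smul, ← smul_neg, map_smul, Pi.smul_apply, smul_eq_mul, RingHom.id_apply]
        ring }
  have hZ : ∀ k a, Z k a = -k a + (K (-k.ofLp) (G.goal a) - K (-k.ofLp) (G.source a)) :=
    fun _ _ => rfl
  let Z' := LinearMap.toContinuousLinearMap Z
  refine ⟨‖Z'‖, norm_nonneg _, fun k hk => ?_⟩
  have hZk : ‖Z k‖ ≤ ‖Z'‖ * ‖k‖ := Z'.le_opNorm k
  have hmean : ∀ q, ∑ a with G.source a = q, G.transition θ f a * Z k a =
      -⟪G.frequency (G.transition θ f) π, k⟫ := by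
    intro q
    have h := hK (-k.ofLp) q
    simp only [hZ]
    simp only [Pi.neg_apply] at h
    rw [h, inner_frequency, ← Finset.sum_neg_distrib]
    exact Finset.sum_congr rfl fun a _ => by ring
  have hratio : ∀ q, |∑ a with G.source a = q, G.transition θ f a * Real.exp (Z k a) -
      (1 - ⟪G.frequency (G.transition θ f) π, k⟫)| ≤ (‖Z'‖ * ‖k‖) ^ 2 := by
    intro q
    rw [sub_eq_add_neg 1, ← hmean q, ← hM.sum_eq_one q, ← Finset.sum_add_distrib,
      ← Finset.sum_sub_distrib]
    refine (Finset.abs_sum_le_sum_abs _ _).trans ?_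
    rw [← hM.mean_const ((‖Z'‖ * ‖k‖) ^ 2) q]
    refine Finset.sum_le_sum fun a _ => ?_
    have h1 : |Z k a| ≤ ‖Z'‖ * ‖k‖ := (norm_le_pi_norm (Z k) a).trans hZk
    have h2 := Real.abs_exp_sub_one_sub_id_le (h1.trans hk)
    calc |G.transition θ f a * Real.exp (Z k a) -
          (G.transition θ f a + G.transition θ f a * Z k a)|
        = G.transition θ f a * |Real.exp (Z k a) - 1 - Z k a| := by
          rw [← abs_of_pos (hM.pos a), ← abs_mul, abs_of_pos (hM.pos a)]
          congr 1
          ring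
      _ ≤ G.transition θ f a * (‖Z'‖ * ‖k‖) ^ 2 := by
          refine mul_le_mul_of_nonneg_left (h2.trans ?_) (hM.pos a).le
          exact sq_le_sq' (by linarith [neg_le_of_abs_le h1]) (le_of_abs_le h1)
  rw [← mul_pow, abs_le]
  have hpos : ∀ q, 0 < f q * Real.exp (K (-k.ofLp) q) := fun q => mul_pos (hf q) (Real.exp_pos _)
  constructor
  · rw [neg_le_sub_iff_le_add, ← sub_le_iff_le_add]
    -- `le_lam` requires a nonnegative constant; a negative one is a trivial lower bound.
    rcases le_or_gt 0 (1 - ⟪G.frequency (G.transition θ f) π, k⟫ - (‖Z'‖ * ‖k‖) ^ 2) with h0 | h0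
    · refine G.le_lam (θ + k) hpos h0 fun q => ?_
      rw [transfer_add_exp hf]
      refine mul_le_mul_of_nonneg_right ?_ (hpos q).le
      have := (abs_le.1 (hratio q)).1
      simp only [hZ] at this
      linarith
    · exact h0.le.trans (lam_nonneg _)
  · rw [sub_le_iff_le_add]
    refine G.lam_le (θ + k) hpos fun q => ?_
    rw [transfer_add_exp hf]
    refine mul_le_mul_of_nonneg_right ?_ (hpos q).le
    have := (abs_le.1 (hratio q)).2
    simp only [hZ] at this
    linarith

theorem Connected.hasGradientAt_lam (hG : G.Connected) [Nonempty Q] (hf : ∀ q, 0 < f q)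
    (hM : G.IsMarkov (G.transition θ f) π) :
    HasGradientAt G.lam (-G.frequency (G.transition θ f) π) θ := by
  obtain ⟨C, hC, h⟩ := hG.abs_lam_add_sub_le hf hM
  -- The estimate at `k = 0` recovers the value at `θ`.
  have h1 : G.lam θ = 1 := by
    have := h 0 (by simp)
    simp only [add_zero, inner_zero_right, sub_zero, norm_zero] at this
    rw [zero_pow two_ne_zero, mul_zero, abs_nonpos_iff, sub_eq_zero] at this
    exact this
  rw [hasGradientAt_iff_hasFDerivAt, hasFDerivAt_iff_isLittleO_nhds_zero]
  refine Asymptotics.IsBigO.trans_isLittleO (g := fun k : EuclideanSpace ℝ A => ‖k‖ ^ 2) ?_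
    (Asymptotics.isLittleO_norm_pow_id one_lt_two)
  refine Asymptotics.IsBigO.of_bound (C ^ 2) ?_
  have hev : ∀ᶠ k : EuclideanSpace ℝ A in 𝓝 0, C * ‖k‖ < 1 := by
    refine Tendsto.eventually_lt_const (v := 0) one_pos ?_
    have : Continuous fun k : EuclideanSpace ℝ A => C * ‖k‖ := by fun_prop
    simpa using this.tendsto 0
  filter_upwards [hev] with k hk
  have := h k hk.le
  rw [Real.norm_eq_abs, norm_pow, norm_norm, h1]
  refine le_trans (le_of_eq ?_) this
  congr 1
  rw [InnerProductSpace.toDual_apply_apply, inner_neg_left]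
  ring

theorem Connected.drift_eq_frequency (hG : G.Connected) [Nonempty Q] (hθ : G.lam θ = 1)
    (hf : ∀ q, 0 < f q) (hM : G.IsMarkov (G.transition θ f) π) :
    G.drift θ = G.frequency (G.transition θ f) π := by
  have h := (hG.hasGradientAt_lam hf hM).hasFDerivAt.log (by rw [hθ]; exact one_ne_zero)
  rw [hθ, inv_one, one_smul] at h
  rw [drift, HasGradientAt.gradient (hasGradientAt_iff_hasFDerivAt.2 h), neg_neg]

end ArrowGraph

/-! ### Period, cyclic classes and convergence to equilibrium. -/

namespace ArrowGraph

section Period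

variable {Q A : Type*} {G : ArrowGraph Q A}

theorem Reach.period_dvd {n : ℕ} {q : Q} (h : G.Reach n q q) : G.period q ∣ n :=
  Nat.setGcd_dvd_of_mem h

theorem Connected.period_dvd_of_reach (hG : G.Connected) {n : ℕ} {q : Q} (h : G.Reach n q q)
    (r : Q) : G.period r ∣ n := by
  obtain ⟨l, hl⟩ := hG.exists_reach r q
  obtain ⟨m, hm⟩ := hG.exists_reach q r
  have h1 := ((hl.trans h).trans hm).period_dvd
  have h2 := (hl.trans hm).period_dvd
  rw [add_right_comm] at h1
  exact (Nat.dvd_add_right h2).1 h1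

theorem Connected.period_eq (hG : G.Connected) (q r : Q) : G.period q = G.period r :=
  Nat.dvd_antisymm (Nat.dvd_setGcd_iff.2 fun _ hn => hG.period_dvd_of_reach hn q)
    (Nat.dvd_setGcd_iff.2 fun _ hn => hG.period_dvd_of_reach hn r)

/-- Closing both paths by the same return path gives two loops, whose lengths are multiples of the
period. -/
theorem Connected.modEq_of_reach (hG : G.Connected) {m n : ℕ} {q q' : Q} (hm : G.Reach m q q')
    (hn : G.Reach n q q') (r : Q) : m ≡ n [MOD G.period r] := by
  obtain ⟨l, hl⟩ := hG.exists_reach q' q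
  have h1 := (Nat.modEq_zero_iff_dvd.2 (hG.period_dvd_of_reach (hm.trans hl) r))
  have h2 := (Nat.modEq_zero_iff_dvd.2 (hG.period_dvd_of_reach (hn.trans hl) r))
  exact Nat.ModEq.add_right_cancel' l (h1.trans h2.symm)

theorem Connected.period_pos (hG : G.Connected) [Nonempty A] (q : Q) : 0 < G.period q := by
  obtain ⟨a⟩ := ‹Nonempty A›
  obtain ⟨n, hn⟩ := hG.exists_reach (G.goal a) (G.source a)
  rw [hG.period_eq q (G.source a)]
  refine Nat.pos_of_ne_zero fun h => ?_
  have h1 := (G.reach_one a).trans hn |>.period_dvd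
  rw [h, zero_dvd_iff] at h1
  omega

/-- All sufficiently long lengths allowed by the period are realized. -/
theorem exists_forall_reach_self (G : ArrowGraph Q A) (q : Q) :
    ∃ N, ∀ n ≥ N, G.period q ∣ n → G.Reach n q q := by
  let S : AddSubmonoid ℕ :=
    { carrier := {n | G.Reach n q q}
      add_mem' := fun h h' => h.trans h'
      zero_mem' := (G.reach_zero).2 rfl }
  obtain ⟨N, hN⟩ := Nat.exists_mem_closure_of_ge (S : Set ℕ)
  refine ⟨N, fun n hn hd => ?_⟩
  have := hN n hn hd
  rw [AddSubmonoid.closure_eq] at this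
  exact this

variable [Fintype Q]

theorem Connected.mem_cyclicClass (hG : G.Connected) {q q' : Q} {n : ℕ} (r : Q) :
    q' ∈ G.cyclicClass q n ↔ ∃ m, m ≡ n [MOD G.period r] ∧ G.Reach m q q' := by
  rw [hG.period_eq r q]
  simp [cyclicClass, Reach]

theorem Connected.mem_cyclicClass_of_reach (hG : G.Connected) {q q' : Q} {n : ℕ}
    (h : G.Reach n q q') : q' ∈ G.cyclicClass q n :=
  (hG.mem_cyclicClass q).2 ⟨n, rfl, h⟩

/-- A long loop at `q` followed by a fixed path to `q'`: the loop absorbs the remaining length,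
which is a multiple of the period. -/
theorem Connected.exists_forall_reach (hG : G.Connected) :
    ∃ N, ∀ n ≥ N, ∀ q, ∀ q' ∈ G.cyclicClass q n, G.Reach n q q' := by
  choose N hN using G.exists_forall_reach_self
  choose l hl using hG.exists_reach
  refine ⟨Finset.univ.sup N + Finset.univ.sup fun u : Q × Q => l u.1 u.2, fun n hn q q' h => ?_⟩
  obtain ⟨m, hm, hr⟩ := (hG.mem_cyclicClass q).1 h
  have h1 : N q ≤ Finset.univ.sup N := Finset.le_sup (Finset.mem_univ q)
  have h2 : l q q' ≤ Finset.univ.sup fun u : Q × Q => l u.1 u.2 :=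
    Finset.le_sup (f := fun u : Q × Q => l u.1 u.2) (Finset.mem_univ (q, q'))
  have h3 : l q q' ≡ n [MOD G.period q] := (hG.modEq_of_reach (hl q q') hr q).trans hm
  have h4 : G.period q ∣ n - l q q' := (Nat.modEq_iff_dvd' (by omega)).1 h3
  have := (hN q _ (by omega) h4).trans (hl q q')
  rwa [Nat.sub_add_cancel (by omega)] at this

theorem Connected.goal_mem_cyclicClass_iff (hG : G.Connected) (q : Q) (n : ℕ) (a : A) :
    G.goal a ∈ G.cyclicClass q (n + 1) ↔ G.source a ∈ G.cyclicClass q n := by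
  rw [hG.mem_cyclicClass q, hG.mem_cyclicClass q]
  constructor
  · rintro ⟨m, hm, hr⟩
    obtain ⟨l, hl⟩ := hG.exists_reach q (G.source a)
    have h := hG.modEq_of_reach (hl.trans (G.reach_one a)) hr q
    exact ⟨l, Nat.ModEq.add_right_cancel' 1 (h.trans hm), hl⟩
  · rintro ⟨m, hm, hr⟩
    exact ⟨m + 1, hm.add_right 1, hr.trans (G.reach_one a)⟩

theorem Connected.cyclicClass_goal (hG : G.Connected) (n : ℕ) (a : A) :
    G.cyclicClass (G.goal a) n = G.cyclicClass (G.source a) (n + 1) := by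
  ext q'
  rw [hG.mem_cyclicClass (G.source a), hG.mem_cyclicClass (G.source a)]
  constructor
  · rintro ⟨m, hm, hr⟩
    refine ⟨1 + m, ?_, (G.reach_one a).trans hr⟩
    rw [add_comm n]
    exact hm.add_left 1
  · rintro ⟨m, hm, hr⟩
    obtain ⟨l, hl⟩ := hG.exists_reach (G.goal a) q'
    have h := hG.modEq_of_reach ((G.reach_one a).trans hl) hr (G.source a)
    refine ⟨l, Nat.ModEq.add_left_cancel' 1 (h.trans ?_), hl⟩
    rwa [add_comm 1]

/-- Paths of equal length from states of the same class end in the same class. -/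
theorem Connected.mem_cyclicClass_zero_of_reach (hG : G.Connected) {n : ℕ} {q q' s t : Q}
    (hq : q' ∈ G.cyclicClass q 0) (hs : G.Reach n q s) (ht : G.Reach n q' t) :
    t ∈ G.cyclicClass s 0 := by
  obtain ⟨m, hm, hr⟩ := (hG.mem_cyclicClass q).1 hq
  obtain ⟨l, hl⟩ := hG.exists_reach s q
  refine (hG.mem_cyclicClass q).2 ⟨l + m + n, ?_, (hl.trans hr).trans ht⟩
  have h := (hG.period_dvd_of_reach (hs.trans hl) q)
  rw [Nat.modEq_zero_iff_dvd] at hm ⊢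
  have h2 := dvd_add h hm
  rwa [show n + l + m = l + m + n by ring] at h2

theorem Connected.mem_cyclicClass_of_reach_of_mem (hG : G.Connected) {n : ℕ} {q q' r : Q}
    (hq : q' ∈ G.cyclicClass q 0) (h : G.Reach n q r) : r ∈ G.cyclicClass q' n := by
  obtain ⟨m, hm, hr⟩ := (hG.mem_cyclicClass q).1 hq
  obtain ⟨l, hl⟩ := hG.exists_reach q' q
  refine (hG.mem_cyclicClass q).2 ⟨l + n, ?_, hl.trans h⟩
  have h1 := hG.period_dvd_of_reach (hr.trans hl) q
  rw [Nat.modEq_zero_iff_dvd] at hm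
  have h2 : l ≡ 0 [MOD G.period q] := Nat.modEq_zero_iff_dvd.2 ((Nat.dvd_add_right hm).1 h1)
  simpa using h2.add_right n

end Period

variable {Q A : Type*} [Fintype Q] [DecidableEq Q] [Fintype A]

/-- The Markov operator `(B f)(q) = ∑ p(a) f(γ(a))`, the sum being over the arrows with
source `q`. -/
noncomputable def markovOp (G : ArrowGraph Q A) (p : A → ℝ) : (Q → ℝ) →ₗ[ℝ] (Q → ℝ) where
  toFun f q := ∑ a with G.source a = q, p a * f (G.goal a)
  map_add' f g := by
    ext q
    simp [mul_add, Finset.sum_add_distrib]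
  map_smul' c f := by
    ext q
    simp [Finset.mul_sum, mul_left_comm]

variable {G : ArrowGraph Q A} {p : A → ℝ} {π : Q → ℝ}

theorem markovOp_apply (f : Q → ℝ) (q : Q) :
    G.markovOp p f q = ∑ a with G.source a = q, p a * f (G.goal a) := rfl

theorem markovOp_pow_succ (f : Q → ℝ) (n : ℕ) (q : Q) :
    (G.markovOp p ^ (n + 1)) f q =
      ∑ a with G.source a = q, p a * (G.markovOp p ^ n) f (G.goal a) := by
  rw [pow_succ', Module.End.mul_apply, markovOp_apply]

/-- The transition probability from `q` to `q'` in `n` steps. -/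
noncomputable def stepProb (G : ArrowGraph Q A) (p : A → ℝ) (n : ℕ) (q q' : Q) : ℝ :=
  (G.markovOp p ^ n) (Pi.single q' 1) q

theorem markovOp_pow_apply (f : Q → ℝ) (n : ℕ) (q : Q) :
    (G.markovOp p ^ n) f q = ∑ q', G.stepProb p n q q' * f q' := by
  conv_lhs => rw [pi_eq_sum_univ' f, map_sum, Finset.sum_apply]
  refine Finset.sum_congr rfl fun q' _ => ?_
  rw [map_smul, Pi.smul_apply, smul_eq_mul, mul_comm, stepProb]

namespace IsMarkov

theorem markovOp_pow_const (hM : G.IsMarkov p π) (n : ℕ) (c : ℝ) :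
    (G.markovOp p ^ n) (fun _ => c) = fun _ => c := by
  induction n with
  | zero => simp
  | succ n ih =>
    ext q
    simp only [markovOp_pow_succ, ih, hM.mean_const]

theorem sum_stepProb (hM : G.IsMarkov p π) (n : ℕ) (q : Q) : ∑ q', G.stepProb p n q q' = 1 := by
  have := markovOp_pow_apply (G := G) (p := p) (fun _ => 1) n q
  rw [hM.markovOp_pow_const] at this
  simpa using this.symm

theorem stepProb_nonneg (hM : G.IsMarkov p π) (n : ℕ) (q q' : Q) : 0 ≤ G.stepProb p n q q' := by
  induction n generalizing q with
  | zero =>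
    rw [stepProb, pow_zero, Module.End.one_apply, Pi.single_apply]
    split_ifs <;> norm_num
  | succ n ih =>
    rw [stepProb, markovOp_pow_succ]
    exact Finset.sum_nonneg fun a _ => mul_nonneg (hM.pos a).le (ih _)

theorem stepProb_pos_iff (hM : G.IsMarkov p π) {n : ℕ} {q q' : Q} :
    0 < G.stepProb p n q q' ↔ G.Reach n q q' := by
  induction n generalizing q with
  | zero =>
    rw [stepProb, pow_zero, Module.End.one_apply, Pi.single_apply, reach_zero]
    split_ifs with h <;> simp [h]
  | succ n ih =>
    rw [stepProb, markovOp_pow_succ, reach_succ]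
    change 0 < ∑ a with G.source a = q, p a * G.stepProb p n (G.goal a) q' ↔ _
    rw [Finset.sum_pos_iff_of_nonneg fun a _ =>
      mul_nonneg (hM.pos a).le (hM.stepProb_nonneg n _ _)]
    simp only [Finset.mem_filter, Finset.mem_univ, true_and]
    refine exists_congr fun a => and_congr_right fun _ => ?_
    rw [mul_pos_iff_of_pos_left (hM.pos a), ih]

/-- Stationarity tested on `ψ` cut off to one class: an arrow ends in class `n + 1` exactly when it
starts in class `n`. -/
theorem stationary_cyclicClass (hM : G.IsMarkov p π) (hG : G.Connected) (ψ : Q → ℝ) (q : Q)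
    (n : ℕ) : ∑ q' ∈ G.cyclicClass q (n + 1), π q' * ψ q' =
      ∑ q' ∈ G.cyclicClass q n, π q' * G.markovOp p ψ q' := by
  have h := hM.stationary fun q' => if q' ∈ G.cyclicClass q (n + 1) then ψ q' else 0
  simp only [mul_ite, mul_zero, Finset.sum_ite_mem, Finset.univ_inter] at h
  rw [← h]
  have h2 := G.sum_mul_sum_source (fun q' => if q' ∈ G.cyclicClass q n then π q' else 0)
    fun a => p a * ψ (G.goal a)
  simp only [ite_mul, zero_mul, Finset.sum_ite_mem, Finset.univ_inter] at h2
  simp only [markovOp_apply, h2, hG.goal_mem_cyclicClass_iff]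

theorem sum_cyclicClass_markovOp_pow (hM : G.IsMarkov p π) (hG : G.Connected) (ψ : Q → ℝ) (q : Q)
    (n : ℕ) : ∑ q' ∈ G.cyclicClass q n, π q' * ψ q' =
      ∑ q' ∈ G.cyclicClass q 0, π q' * (G.markovOp p ^ n) ψ q' := by
  induction n generalizing ψ with
  | zero => simp
  | succ n ih => rw [hM.stationary_cyclicClass hG, ih, pow_succ]; rfl

theorem nonempty_arrows (hM : G.IsMarkov p π) [Nonempty Q] : Nonempty A := by
  obtain ⟨q⟩ := ‹Nonempty Q›
  by_contra h
  rw [not_nonempty_iff] at h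
  simpa using hM.sum_eq_one q

/-- Stationarity gives all cyclic classes the same mass. -/
theorem period_mul_sum_cyclicClass (hM : G.IsMarkov p π) (hG : G.Connected) (q : Q) (n : ℕ) :
    G.period q * ∑ q' ∈ G.cyclicClass q n, π q' = 1 := by
  have : Nonempty Q := ⟨q⟩
  have := hM.nonempty_arrows
  have h0 : ∀ n, ∑ q' ∈ G.cyclicClass q n, π q' = ∑ q' ∈ G.cyclicClass q 0, π q' := by
    intro n
    have := hM.sum_cyclicClass_markovOp_pow hG (fun _ => 1) q n
    rw [hM.markovOp_pow_const] at this
    simpa using this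
  -- The classes for `n` below the period partition the states.
  have h1 : ∑ n ∈ Finset.range (G.period q), ∑ q' ∈ G.cyclicClass q n, π q' = 1 := by
    rw [← hM.stat_sum]
    have : ∀ n, ∑ q' ∈ G.cyclicClass q n, π q' =
        ∑ q', if q' ∈ G.cyclicClass q n then π q' else 0 := by simp
    simp only [this]
    rw [Finset.sum_comm]
    refine Finset.sum_congr rfl fun q' _ => ?_
    obtain ⟨m, hm⟩ := hG.exists_reach q q'
    have hlt : m % G.period q < G.period q := Nat.mod_lt _ (hG.period_pos q)
    rw [Finset.sum_eq_single_of_mem (m % G.period q) (Finset.mem_range.2 hlt), if_pos]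
    · exact (hG.mem_cyclicClass q).2 ⟨m, (Nat.mod_modEq m _).symm, hm⟩
    · intro n hn hne
      rw [if_neg]
      intro h
      obtain ⟨l, hl, hr⟩ := (hG.mem_cyclicClass q).1 h
      refine hne ?_
      rw [← Nat.mod_eq_of_lt (Finset.mem_range.1 hn)]
      exact (hl.symm.trans (hG.modEq_of_reach hr hm q))
  simp only [h0, Finset.sum_const, Finset.card_range, nsmul_eq_mul] at h1
  rw [h0, h1]

/-- Run two independent chains from `q` and `q'`. Their endpoints lie in a common class, so each
pair of endpoints contributes at most `c`, and the pair `(r, r)` contributes nothing. -/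
theorem markovOp_pow_sub_le (hM : G.IsMarkov p π) (hG : G.Connected) {ψ : Q → ℝ} {c : ℝ}
    (hψ : ∀ s, ∀ t ∈ G.cyclicClass s 0, ψ s - ψ t ≤ c) (n : ℕ) {q q' : Q}
    (hq : q' ∈ G.cyclicClass q 0) (r : Q) :
    (G.markovOp p ^ n) ψ q - (G.markovOp p ^ n) ψ q' ≤
      c * (1 - G.stepProb p n q r * G.stepProb p n q' r) := by
  have h1 : (G.markovOp p ^ n) ψ q - (G.markovOp p ^ n) ψ q' =
      ∑ s, ∑ t, G.stepProb p n q s * G.stepProb p n q' t * (ψ s - ψ t) := by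
    simp only [mul_sub, Finset.sum_sub_distrib]
    congr 1
    · rw [markovOp_pow_apply]
      refine Finset.sum_congr rfl fun s _ => ?_
      rw [← Finset.sum_mul, ← Finset.mul_sum, hM.sum_stepProb, mul_one]
    · rw [Finset.sum_comm, markovOp_pow_apply]
      refine Finset.sum_congr rfl fun s _ => ?_
      rw [← Finset.sum_mul, ← Finset.sum_mul, hM.sum_stepProb, one_mul]
  have h2 : c * (1 - G.stepProb p n q r * G.stepProb p n q' r) =
      ∑ s, ∑ t, (G.stepProb p n q s * G.stepProb p n q' t * c -
        if s = r ∧ t = r then G.stepProb p n q s * G.stepProb p n q' t * c else 0) := by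
    simp only [Finset.sum_sub_distrib, ite_and]
    simp [← Finset.sum_mul, ← Finset.mul_sum, hM.sum_stepProb]
    ring
  rw [h1, h2]
  refine Finset.sum_le_sum fun s _ => Finset.sum_le_sum fun t _ => ?_
  split_ifs with h
  · obtain ⟨rfl, rfl⟩ := h
    simp
  · rw [sub_zero]
    have hs := hM.stepProb_nonneg n q s
    have ht := hM.stepProb_nonneg n q' t
    rcases hs.eq_or_lt with h0 | h0
    · simp [← h0]
    rcases ht.eq_or_lt with h0' | h0'
    · simp [← h0']
    exact mul_le_mul_of_nonneg_left (hψ s t (hG.mem_cyclicClass_zero_of_reach hq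
      (hM.stepProb_pos_iff.1 h0) (hM.stepProb_pos_iff.1 h0'))) (mul_nonneg hs ht)

/-- Doeblin's condition: after enough steps, chains started in the same class can meet at a common
state, with probability bounded below. -/
theorem exists_contraction (hM : G.IsMarkov p π) (hG : G.Connected) [Nonempty Q] :
    ∃ N : ℕ, 0 < N ∧ ∃ δ : ℝ, 0 < δ ∧ δ ≤ 1 ∧ ∀ (ψ : Q → ℝ) (c : ℝ),
      (∀ s, ∀ t ∈ G.cyclicClass s 0, ψ s - ψ t ≤ c) →
      ∀ s, ∀ t ∈ G.cyclicClass s 0,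
        (G.markovOp p ^ N) ψ s - (G.markovOp p ^ N) ψ t ≤ (1 - δ) * c := by
  obtain ⟨N₀, hN₀⟩ := hG.exists_forall_reach
  -- The extra step makes `N` positive, as needed for dividing the time by `N`.
  set N := N₀ + 1
  -- Zero probabilities are replaced by `1`, so the minimum over all pairs is positive and bounds
  -- below every nonzero probability.
  obtain ⟨u, hu⟩ := Finite.exists_min fun u : Q × Q =>
    if G.stepProb p N u.1 u.2 = 0 then 1 else G.stepProb p N u.1 u.2
  set ε : ℝ := if G.stepProb p N u.1 u.2 = 0 then 1 else G.stepProb p N u.1 u.2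
  have hε : 0 < ε := by
    simp only [ε]
    split_ifs with h
    · exact one_pos
    · exact lt_of_le_of_ne (hM.stepProb_nonneg _ _ _) (Ne.symm h)
  have hle : ∀ q r, G.Reach N q r → ε ≤ G.stepProb p N q r := by
    intro q r h
    have := hu (q, r)
    rwa [if_neg (hM.stepProb_pos_iff.2 h).ne'] at this
  have hone : ∀ q r, G.stepProb p N q r ≤ 1 := fun q r => by
    rw [← hM.sum_stepProb N q]
    exact Finset.single_le_sum (fun r _ => hM.stepProb_nonneg N q r) (Finset.mem_univ r)
  have hex : ∀ q, ∃ r, G.Reach N q r := by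
    intro q
    by_contra! h
    have h0 := hM.sum_stepProb N q
    rw [Finset.sum_eq_zero fun r _ => le_antisymm
      (not_lt.1 fun h' => h r (hM.stepProb_pos_iff.1 h')) (hM.stepProb_nonneg N q r)] at h0
    exact zero_ne_one h0
  have hε1 : ε ≤ 1 := by
    obtain ⟨q⟩ := ‹Nonempty Q›
    obtain ⟨r, hr⟩ := hex q
    exact (hle q r hr).trans (hone q r)
  refine ⟨N, Nat.succ_pos _, ε * ε, mul_pos hε hε, mul_le_one₀ hε1 hε.le hε1,
    fun ψ c hψ s t ht => ?_⟩
  obtain ⟨r, hr⟩ := hex s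
  have hr' := hN₀ N (Nat.le_succ _) t r (hG.mem_cyclicClass_of_reach_of_mem ht hr)
  have hc : 0 ≤ c := by
    simpa using hψ s s (hG.mem_cyclicClass_of_reach (G.reach_zero.2 rfl))
  refine (hM.markovOp_pow_sub_le hG hψ N ht r).trans ?_
  rw [mul_comm]
  refine mul_le_mul_of_nonneg_right ?_ hc
  exact sub_le_sub_left (mul_le_mul (hle s r hr) (hle t r hr') hε.le
    (hM.stepProb_nonneg _ _ _)) _

/-- Convergence of a periodic Markov chain to the equilibrium on its cyclic classes. -/
theorem tendsto_markovOp_pow (hM : G.IsMarkov p π) (hG : G.Connected) (ψ : Q → ℝ) (q : Q) :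
    Tendsto (fun n => (G.markovOp p ^ n) ψ q -
      G.period q * ∑ q' ∈ G.cyclicClass q n, π q' * ψ q') atTop (𝓝 0) := by
  have : Nonempty Q := ⟨q⟩
  obtain ⟨N, hN, δ, hδ, hδ1, hcontr⟩ := hM.exists_contraction hG
  obtain ⟨c, hc0, hc⟩ : ∃ c : ℝ, 0 ≤ c ∧ ∀ s t, ψ s - ψ t ≤ c := by
    obtain ⟨u, hu⟩ := Finite.exists_max fun u : Q × Q => ψ u.1 - ψ u.2
    exact ⟨_, by simpa using hu (q, q), fun s t => hu (s, t)⟩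
  -- The oscillation inside classes decays geometrically along blocks of length `N`; by stationarity
  -- the equilibrium value is the mean of the same iterate over the class of `q`, so it is within
  -- this oscillation.
  have hosc : ∀ j i : ℕ, ∀ s, ∀ t ∈ G.cyclicClass s 0,
      (G.markovOp p ^ (N * j + i)) ψ s - (G.markovOp p ^ (N * j + i)) ψ t ≤ (1 - δ) ^ j * c := by
    intro j i
    induction j with
    | zero =>
      intro s t ht
      have := hM.markovOp_pow_sub_le hG (fun s t _ => hc s t) i ht s
      rw [mul_zero, zero_add, pow_zero, one_mul]
      refine this.trans (mul_le_of_le_one_right hc0 ?_)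
      exact sub_le_self _ (mul_nonneg (hM.stepProb_nonneg _ _ _) (hM.stepProb_nonneg _ _ _))
    | succ j ih =>
      have := hcontr _ _ ih
      rw [← Module.End.mul_apply, ← pow_add] at this
      rw [pow_succ', mul_assoc, show N * (j + 1) + i = N + (N * j + i) by ring]
      exact this
  have hlim : Tendsto (fun n => (1 - δ) ^ (n / N) * c) atTop (𝓝 0) := by
    rw [← zero_mul c]
    exact ((tendsto_pow_atTop_nhds_zero_of_lt_one (by linarith) (by linarith)).comp
      (Nat.tendsto_div_const_atTop hN.ne')).mul_const c
  refine squeeze_zero_norm (fun n => ?_) hlim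
  have hq : ∀ t ∈ G.cyclicClass q 0,
      |(G.markovOp p ^ n) ψ q - (G.markovOp p ^ n) ψ t| ≤ (1 - δ) ^ (n / N) * c := by
    intro t ht
    have ht' : q ∈ G.cyclicClass t 0 :=
      hG.mem_cyclicClass_of_reach_of_mem ht (G.reach_zero.2 rfl)
    have h1 := hosc (n / N) (n % N) q t ht
    have h2 := hosc (n / N) (n % N) t q ht'
    rw [Nat.div_add_mod] at h1 h2
    exact abs_le.2 ⟨by linarith, h1⟩
  have h1 := hM.period_mul_sum_cyclicClass hG q 0
  rw [hM.sum_cyclicClass_markovOp_pow hG, Real.norm_eq_abs]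
  calc |(G.markovOp p ^ n) ψ q -
        G.period q * ∑ q' ∈ G.cyclicClass q 0, π q' * (G.markovOp p ^ n) ψ q'|
      = |G.period q * ∑ q' ∈ G.cyclicClass q 0,
          π q' * ((G.markovOp p ^ n) ψ q - (G.markovOp p ^ n) ψ q')| := by
        congr 1
        simp only [mul_sub, Finset.sum_sub_distrib, ← Finset.sum_mul]
        rw [← mul_assoc, h1, one_mul]
    _ ≤ G.period q * ∑ q' ∈ G.cyclicClass q 0, π q' * ((1 - δ) ^ (n / N) * c) := by
        rw [abs_mul, Nat.abs_cast]
        refine mul_le_mul_of_nonneg_left ((Finset.abs_sum_le_sum_abs _ _).trans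
          (Finset.sum_le_sum fun t ht => ?_)) (Nat.cast_nonneg _)
        rw [abs_mul, abs_of_pos (hM.stat_pos t)]
        exact mul_le_mul_of_nonneg_left (hq t ht) (hM.stat_pos t).le
    _ = _ := by rw [← Finset.sum_mul, ← mul_assoc, h1, one_mul]

end IsMarkov

end ArrowGraph

/-! ### The centered walk, its martingale part and the law of large numbers. -/

namespace ArrowGraph

variable {Q A : Type*} [Fintype Q] [DecidableEq Q] [Fintype A] [DecidableEq A]

/-- The centered increment of the letter count along the arrow `a`. -/
noncomputable def increment (x : EuclideanSpace ℝ A) (a : A) : EuclideanSpace ℝ A :=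
  EuclideanSpace.single a 1 - x

/-- The transition operator of the Markov chain on pairs (state, centered letter count). -/
noncomputable def walkOp (G : ArrowGraph Q A) (p : A → ℝ) (x : EuclideanSpace ℝ A) (V : Type*)
    [AddCommGroup V] [Module ℝ V] :
    (Q → EuclideanSpace ℝ A → V) →ₗ[ℝ] (Q → EuclideanSpace ℝ A → V) where
  toFun F q y := ∑ a with G.source a = q, p a • F (G.goal a) (y + increment x a)
  map_add' F F' := by
    ext q y
    simp [smul_add, Finset.sum_add_distrib]
  map_smul' c F := by
    ext q y
    simp [Finset.smul_sum, smul_comm c]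

variable {G : ArrowGraph Q A} {p : A → ℝ} {π : Q → ℝ} {x : EuclideanSpace ℝ A}

section

variable {V : Type*} [AddCommGroup V] [Module ℝ V]

theorem walkOp_apply (F : Q → EuclideanSpace ℝ A → V) (q : Q) (y : EuclideanSpace ℝ A) :
    G.walkOp p x V F q y =
      ∑ a with G.source a = q, p a • F (G.goal a) (y + increment x a) := rfl

theorem walkOp_pow_succ (F : Q → EuclideanSpace ℝ A → V) (n : ℕ) (q : Q)
    (y : EuclideanSpace ℝ A) :
    (G.walkOp p x V ^ (n + 1)) F q y = ∑ a with G.source a = q,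
      p a • (G.walkOp p x V ^ n) F (G.goal a) (y + increment x a) := by
  rw [pow_succ', Module.End.mul_apply, walkOp_apply]

theorem letterCount_inner_cons (θ : EuclideanSpace ℝ A) {n : ℕ} (a : A) (w : Fin n → A) :
    ⟪θ, letterCount (Fin.cons a w : Fin (n + 1) → A)⟫ = θ a + ⟪θ, letterCount w⟫ := by
  rw [letterCount_cons, inner_add_right, EuclideanSpace.inner_single_right]
  simp

/-- Weighted sums over paths in terms of the walk. -/
theorem sum_pathsFrom_eq_walkOp_pow {θ : EuclideanSpace ℝ A} {f : Q → ℝ} (hf : ∀ q, 0 < f q)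
    (F : EuclideanSpace ℝ A → V) (n : ℕ) (q : Q) (y : EuclideanSpace ℝ A) :
    ∑ w ∈ G.pathsFrom n q, Real.exp (-⟪θ, letterCount w⟫) •
        F (y + (letterCount w - (n : ℝ) • x)) =
      f q • (G.walkOp (G.transition θ f) x V ^ n) (fun q' z => (f q')⁻¹ • F z) q y := by
  induction n generalizing q y with
  | zero =>
    rw [sum_pathsFrom_zero]
    simp [letterCount_zero, smul_smul, (hf q).ne']
  | succ n ih =>
    rw [sum_pathsFrom_succ, walkOp_pow_succ, Finset.smul_sum]
    refine Finset.sum_congr rfl fun a ha => ?_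
    have h := congrArg (Real.exp (-θ a) • ·) (ih (G.goal a) (y + increment x a))
    simp only [Finset.smul_sum, smul_smul] at h
    rw [smul_smul, transition, (Finset.mem_filter.1 ha).2, mul_div_cancel₀ _ (hf q).ne', ← h]
    refine Finset.sum_congr rfl fun w _ => ?_
    rw [letterCount_inner_cons, neg_add, Real.exp_add]
    congr 2
    rw [letterCount_cons, increment]
    push_cast
    module

end

namespace IsMarkov

theorem walkOp_mono (hM : G.IsMarkov p π) {F F' : Q → EuclideanSpace ℝ A → ℝ}
    (h : ∀ q y, F q y ≤ F' q y) (q : Q) (y : EuclideanSpace ℝ A) :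
    G.walkOp p x ℝ F q y ≤ G.walkOp p x ℝ F' q y := by
  rw [walkOp_apply, walkOp_apply]
  exact Finset.sum_le_sum fun a _ => mul_le_mul_of_nonneg_left (h _ _) (hM.pos a).le

theorem walkOp_pow_mono (hM : G.IsMarkov p π) {F F' : Q → EuclideanSpace ℝ A → ℝ}
    (h : ∀ q y, F q y ≤ F' q y) (n : ℕ) (q : Q) (y : EuclideanSpace ℝ A) :
    (G.walkOp p x ℝ ^ n) F q y ≤ (G.walkOp p x ℝ ^ n) F' q y := by
  induction n generalizing q y with
  | zero => exact h q y
  | succ n ih =>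
    rw [pow_succ', Module.End.mul_apply, Module.End.mul_apply]
    exact hM.walkOp_mono ih q y

theorem walkOp_pow_const (hM : G.IsMarkov p π) (c : ℝ) (n : ℕ) :
    (G.walkOp p x ℝ ^ n) (fun _ _ => c) = fun _ _ => c := by
  induction n with
  | zero => rfl
  | succ n ih =>
    ext q y
    simp only [walkOp_pow_succ, ih, smul_eq_mul, hM.mean_const]

theorem norm_walkOp_le (hM : G.IsMarkov p π) {V : Type*} [NormedAddCommGroup V] [NormedSpace ℝ V]
    {F : Q → EuclideanSpace ℝ A → V} {c : ℝ} (h : ∀ q y, ‖F q y‖ ≤ c) (q : Q)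
    (y : EuclideanSpace ℝ A) : ‖G.walkOp p x V F q y‖ ≤ c := by
  rw [walkOp_apply, ← hM.mean_const c q]
  refine (norm_sum_le _ _).trans (Finset.sum_le_sum fun a _ => ?_)
  rw [norm_smul, Real.norm_of_nonneg (hM.pos a).le]
  exact mul_le_mul_of_nonneg_left (h _ _) (hM.pos a).le

theorem norm_walkOp_pow_le (hM : G.IsMarkov p π) {V : Type*} [NormedAddCommGroup V]
    [NormedSpace ℝ V] {F : Q → EuclideanSpace ℝ A → V} {c : ℝ} (h : ∀ q y, ‖F q y‖ ≤ c) (n : ℕ)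
    (q : Q) (y : EuclideanSpace ℝ A) : ‖(G.walkOp p x V ^ n) F q y‖ ≤ c := by
  induction n generalizing q y with
  | zero => exact h q y
  | succ n ih =>
    rw [pow_succ', Module.End.mul_apply]
    exact hM.norm_walkOp_le ih q y

theorem norm_walkOp_pow_sub_le (hM : G.IsMarkov p π) {V : Type*} [NormedAddCommGroup V]
    [NormedSpace ℝ V] {F F' : Q → EuclideanSpace ℝ A → V} {c : ℝ}
    (h : ∀ q y, ‖F q y - F' q y‖ ≤ c) (n : ℕ) (q : Q) (y : EuclideanSpace ℝ A) :
    ‖(G.walkOp p x V ^ n) F q y - (G.walkOp p x V ^ n) F' q y‖ ≤ c := by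
  have := hM.norm_walkOp_pow_le (x := x) (F := F - F') h n q y
  rwa [map_sub] at this

/-- Martingale approximation: up to the gradient of a function linear in `t`, the
increments of `⟪t, ·⟫` along the walk are conditionally centered; they vanish exactly for `t`
orthogonal to the balanced space. -/
theorem exists_martingale_increment (hM : G.IsMarkov p π) (hG : G.Connected) :
    ∃ (H : EuclideanSpace ℝ A →ₗ[ℝ] (A → ℝ)) (U : EuclideanSpace ℝ A →ₗ[ℝ] (Q → ℝ)),
      (∀ t a, H t a = ⟪increment (G.frequency p π) a, t⟫ +
        (U t (G.goal a) - U t (G.source a))) ∧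
      (∀ t q, ∑ a with G.source a = q, p a * H t a = 0) ∧
      ∀ t, H t = 0 ↔ t ∈ G.balancedSpaceᗮ := by
  obtain ⟨K, hK⟩ := hM.exists_corrector hG
  set x := G.frequency p π with hx
  let D : EuclideanSpace ℝ A →ₗ[ℝ] (A → ℝ) :=
    { toFun t a := ⟪increment x a, t⟫
      map_add' s t := by ext a; simp [inner_add_right]
      map_smul' c t := by ext a; simp [inner_smul_right] }
  have hD : ∀ t a, D t a = t a - ⟪x, t⟫ := by
    intro t a
    change ⟪increment x a, t⟫ = _
    rw [increment, inner_sub_left, EuclideanSpace.inner_single_left]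
    simp
  have hsum : ∑ a, π (G.source a) * p a = 1 := by
    rw [← sum_mul_sum_source]
    simp [hM.sum_eq_one, hM.stat_sum]
  have hDmean : ∀ t, ∑ a, π (G.source a) * (p a * D t a) = 0 := by
    intro t
    simp only [hD, mul_sub, Finset.sum_sub_distrib]
    rw [← inner_frequency, ← hx]
    simp only [← mul_assoc, ← Finset.sum_mul, hsum]
    ring
  let H : EuclideanSpace ℝ A →ₗ[ℝ] (A → ℝ) :=
    { toFun t a := D t a + (K (D t) (G.goal a) - K (D t) (G.source a))
      map_add' s t := by
        ext a
        simp only [map_add, Pi.add_apply]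
        ring
      map_smul' c t := by
        ext a
        simp only [map_smul, Pi.smul_apply, smul_eq_mul, RingHom.id_apply]
        ring }
  have hH : ∀ t a, H t a = D t a + (K (D t) (G.goal a) - K (D t) (G.source a)) := fun _ _ => rfl
  have hHmean : ∀ t q, ∑ a with G.source a = q, p a * H t a = 0 := fun t q => by
    simp only [hH, hK, hDmean]
  refine ⟨H, K ∘ₗ D, fun t a => rfl, hHmean, fun t => ?_⟩
  rw [balancedSpace, Submodule.orthogonal_orthogonal]
  constructor
  · intro h
    rw [Submodule.mem_sup]
    -- When the corrected increment vanishes, `t` is its stationary mean plus minus the gradient of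
    -- the corrector.
    refine ⟨⟪x, t⟫ • WithLp.toLp 2 fun _ => (1 : ℝ),
      Submodule.smul_mem _ _ (Submodule.subset_span rfl), G.grad (-K (D t)), ⟨_, rfl⟩, ?_⟩
    ext a
    have h1 := congrFun h a
    rw [hH, hD, Pi.zero_apply] at h1
    simp only [PiLp.add_apply, PiLp.smul_apply, grad, LinearMap.coe_mk, AddHom.coe_mk,
      Pi.neg_apply, smul_eq_mul, mul_one]
    linarith
  · intro h
    suffices hle : Submodule.span ℝ {WithLp.toLp 2 fun _ => (1 : ℝ)} ⊔ LinearMap.range G.grad ≤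
        LinearMap.ker H from hle h
    refine sup_le (Submodule.span_le.2 (Set.singleton_subset_iff.2 ?_)) ?_
    · have h0 : D (WithLp.toLp 2 fun _ => (1 : ℝ)) = 0 := by
        ext a
        rw [hD, hx, inner_frequency]
        simp [hsum]
      change H _ = 0
      ext a
      rw [hH, h0]
      simp
    · rintro _ ⟨w, rfl⟩
      change H _ = 0
      have hDw : ∀ a, D (G.grad w) a = w (G.goal a) - w (G.source a) := by
        intro a
        rw [hD, hx, inner_frequency]
        simp only [grad, LinearMap.coe_mk, AddHom.coe_mk]
        rw [hM.sum_sub_stationary, sub_zero]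
      -- For a gradient the corrected increment is again a gradient, with vanishing conditional
      -- means; its potential is harmonic, hence constant.
      have hharm : ∀ q, ∑ a with G.source a = q, p a * (w + K (D (G.grad w))) (G.goal a) =
          (w + K (D (G.grad w))) q := by
        intro q
        rw [← sub_eq_zero, ← hM.mean_const ((w + K (D (G.grad w))) q) q,
          ← Finset.sum_sub_distrib, ← hHmean (G.grad w) q]
        refine Finset.sum_congr rfl fun a ha => ?_
        rw [hH, hDw, ← (Finset.mem_filter.1 ha).2]
        simp only [Pi.add_apply]
        ring
      ext a
      have := hG.eq_of_harmonic hM.pos hM.sum_eq_one hharm (G.goal a) (G.source a)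
      rw [hH, hDw, Pi.zero_apply]
      simp only [Pi.add_apply] at this
      linarith

/-- The law of large numbers, in `L¹`. -/
theorem tendsto_inv_mul_walkOp_pow_inner (hM : G.IsMarkov p π) (hG : G.Connected) (ψ : Q → ℝ)
    (t : EuclideanSpace ℝ A) (q : Q) :
    Tendsto (fun n : ℕ => (n : ℝ)⁻¹ *
      (G.walkOp p (G.frequency p π) ℝ ^ n) (fun q y => ψ q * ⟪y, t⟫) q 0) atTop (𝓝 0) := by
  obtain ⟨H, U, hH, hH0, -⟩ := hM.exists_martingale_increment hG
  set x := G.frequency p π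
  set M : Q → EuclideanSpace ℝ A → ℝ := fun q y => ⟪y, t⟫ + U t q with hMdef
  set C := ‖H t‖ ^ 2
  have hstep : ∀ q a y, G.source a = q → M (G.goal a) (y + increment x a) = M q y + H t a := by
    rintro _ a y rfl
    rw [hH, hMdef]
    simp only [inner_add_left]
    ring
  -- `M` is a martingale along the walk, so the cross terms cancel and each step adds at most `C` to
  -- the second moment.
  have hsq : ∀ (n : ℕ) q y, (G.walkOp p x ℝ ^ n) (fun q y => M q y ^ 2) q y ≤ M q y ^ 2 + n * C := by
    intro n
    induction n with
    | zero => simp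
    | succ n ih =>
      intro q y
      rw [walkOp_pow_succ]
      calc _ ≤ ∑ a with G.source a = q, p a * ((M q y + H t a) ^ 2 + n * C) := by
            refine Finset.sum_le_sum fun a ha => mul_le_mul_of_nonneg_left ?_ (hM.pos a).le
            rw [← hstep q a y (Finset.mem_filter.1 ha).2]
            exact ih _ _
        _ = M q y ^ 2 + 2 * M q y * ∑ a with G.source a = q, p a * H t a +
            ∑ a with G.source a = q, p a * H t a ^ 2 + n * C := by
            rw [← hM.mean_const (n * C) q]
            conv_rhs => rw [← hM.mean_const (M q y ^ 2) q]
            rw [Finset.mul_sum, ← Finset.sum_add_distrib, ← Finset.sum_add_distrib,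
              ← Finset.sum_add_distrib]
            refine Finset.sum_congr rfl fun a _ => ?_
            rw [hM.mean_const]
            ring
        _ ≤ M q y ^ 2 + 2 * M q y * 0 + C + n * C := by
            rw [hH0, ← hM.mean_const C q]
            gcongr with a
            · exact (hM.pos a).le
            · rw [← sq_abs]
              exact pow_le_pow_left₀ (abs_nonneg _) (norm_le_pi_norm (H t) a) 2
        _ = _ := by push_cast; ring
  have hbound : ∀ n : ℕ, 0 < n → ‖(n : ℝ)⁻¹ *
      (G.walkOp p x ℝ ^ n) (fun q y => ψ q * ⟪y, t⟫) q 0‖ ≤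
        (‖ψ‖ * ‖U t‖ * (√n)⁻¹ + ‖ψ‖ * (1 + U t q ^ 2 + C)) * (√n)⁻¹ := by
    intro n hn
    have hn1 : (1 : ℝ) ≤ n := by exact_mod_cast hn
    have hs : 0 < √(n : ℝ) := Real.sqrt_pos.2 (by linarith)
    have hss : √(n : ℝ) ^ 2 = n := Real.sq_sqrt (by linarith)
    have hs1 : (√(n : ℝ))⁻¹ ≤ 1 := inv_le_one_of_one_le₀ (Real.one_le_sqrt.2 hn1)
    -- The pointwise bound `|M| ≤ √n + M² / √n` turns the second moment of order `n` into a first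
    -- moment of order `√n`.
    set G' : Q → EuclideanSpace ℝ A → ℝ :=
      (fun _ _ => ‖ψ‖ * (‖U t‖ + √n)) + (‖ψ‖ * (√(n : ℝ))⁻¹) • fun q y => M q y ^ 2 with hG'
    have hle : ∀ q y, |ψ q * ⟪y, t⟫| ≤ G' q y := by
      intro q y
      have h1 : |⟪y, t⟫| ≤ |M q y| + ‖U t‖ := by
        have h2 : ⟪y, t⟫ = M q y - U t q := by simp [hMdef]
        rw [h2]
        exact (abs_sub _ _).trans (by gcongr; exact norm_le_pi_norm (U t) q)
      have h3 : |M q y| ≤ √n + (√(n : ℝ))⁻¹ * M q y ^ 2 := by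
        rw [← sq_abs (M q y)]
        rcases le_total (|M q y|) (√n) with h | h
        · have : 0 ≤ (√(n : ℝ))⁻¹ * |M q y| ^ 2 := by positivity
          linarith
        · have : |M q y| ≤ (√(n : ℝ))⁻¹ * |M q y| ^ 2 := by
            rw [inv_mul_eq_div, le_div_iff₀ hs, sq]
            gcongr
          linarith
      calc |ψ q * ⟪y, t⟫| = |ψ q| * |⟪y, t⟫| := abs_mul _ _
        _ ≤ ‖ψ‖ * (√n + (√(n : ℝ))⁻¹ * M q y ^ 2 + ‖U t‖) := by
          gcongr
          · exact norm_le_pi_norm ψ q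
          · linarith
        _ = G' q y := by
          simp only [hG', Pi.add_apply, Pi.smul_apply, smul_eq_mul]
          ring
    have hup := hM.walkOp_pow_mono (x := x) (fun q y => (abs_le.1 (hle q y)).2) n q 0
    have hlo := hM.walkOp_pow_mono (x := x) (F := -G') (fun q y => (abs_le.1 (hle q y)).1) n q 0
    rw [map_neg, Pi.neg_apply, Pi.neg_apply] at hlo
    have hval : (G.walkOp p x ℝ ^ n) G' q 0 ≤
        ‖ψ‖ * (‖U t‖ + √n) + (‖ψ‖ * (√(n : ℝ))⁻¹) * (U t q ^ 2 + n * C) := by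
      rw [hG', map_add, map_smul, hM.walkOp_pow_const]
      simp only [Pi.add_apply, Pi.smul_apply, smul_eq_mul]
      have := hsq n q 0
      simp only [hMdef, inner_zero_left, zero_add] at this ⊢
      gcongr
    rw [norm_mul, Real.norm_of_nonneg (by positivity : (0 : ℝ) ≤ (n : ℝ)⁻¹), Real.norm_eq_abs]
    calc (n : ℝ)⁻¹ * |(G.walkOp p x ℝ ^ n) (fun q y => ψ q * ⟪y, t⟫) q 0|
        ≤ (n : ℝ)⁻¹ * (‖ψ‖ * (‖U t‖ + √n) + (‖ψ‖ * (√(n : ℝ))⁻¹) * (U t q ^ 2 + n * C)) := by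
          gcongr
          exact (abs_le.2 ⟨hlo, hup⟩).trans hval
      _ = (‖ψ‖ * ‖U t‖ * (√n)⁻¹ + ‖ψ‖ * (1 + U t q ^ 2 * (√(n : ℝ))⁻¹ ^ 2 + C)) * (√n)⁻¹ := by
          clear_value G'
          generalize √(n : ℝ) = r at hss hs
          rw [← hss]
          field_simp
          ring
      _ ≤ _ := by
          gcongr
          refine mul_le_of_le_one_right (sq_nonneg _) (pow_le_one₀ (by positivity) hs1)
  have hlim0 : Tendsto (fun n : ℕ => (√(n : ℝ))⁻¹) atTop (𝓝 0) :=
    (Real.tendsto_sqrt_atTop.comp tendsto_natCast_atTop_atTop).inv_tendsto_atTop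
  refine squeeze_zero_norm' (eventually_atTop.2 ⟨1, fun n hn => hbound n hn⟩) ?_
  have := ((hlim0.const_mul (‖ψ‖ * ‖U t‖)).add_const (‖ψ‖ * (1 + U t q ^ 2 + C))).mul hlim0
  simpa using this

end IsMarkov

end ArrowGraph

/-! ### Characteristic functions of the normalized walk. -/

theorem Complex.exp_sub_quadratic_isLittleO (α β : ℂ) :
    (fun s : ℝ => Complex.exp (s * α + s ^ 2 * β) - (1 + s * α + s ^ 2 * (β + α ^ 2 / 2)))
      =o[𝓝 0] fun s : ℝ => s ^ 2 := by
  have hid : Tendsto (fun s : ℝ => s) (𝓝 0) (𝓝 0) := tendsto_id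
  have hc : ∀ (c : ℂ) (k : ℕ), 2 < k →
      (fun s : ℝ => (s : ℂ) ^ k * c) =o[𝓝 0] fun s : ℝ => s ^ 2 := by
    intro c k hk
    refine Asymptotics.IsBigO.trans_isLittleO (g := fun s : ℝ => s ^ k) ?_
      (Asymptotics.isLittleO_pow_pow hk)
    refine Asymptotics.IsBigO.of_bound ‖c‖ (Eventually.of_forall fun s => ?_)
    simp [mul_comm]
  set z : ℝ → ℂ := fun s => s * α + s ^ 2 * β with hz
  have hz0 : Tendsto z (𝓝 0) (𝓝 0) := by
    have : Continuous z := by fun_prop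
    simpa [hz] using this.tendsto 0
  have hzO : z =O[𝓝 0] fun s : ℝ => s := by
    refine Asymptotics.IsBigO.of_bound (‖α‖ + ‖β‖) ?_
    filter_upwards [Metric.ball_mem_nhds (0 : ℝ) one_pos] with s hs
    have hs1 : |s| ≤ 1 := by simpa using (Metric.mem_ball.1 hs).le
    calc ‖z s‖ ≤ ‖(s : ℂ) * α‖ + ‖(s : ℂ) ^ 2 * β‖ := norm_add_le _ _
      _ = |s| * ‖α‖ + |s| * |s| * ‖β‖ := by simp [sq]
      _ ≤ |s| * ‖α‖ + |s| * 1 * ‖β‖ := by gcongr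
      _ = _ := by rw [Real.norm_eq_abs]; ring
  have h1 : (fun s => Complex.exp (z s) - ∑ i ∈ Finset.range 3, z s ^ i / i.factorial)
      =o[𝓝 0] fun s : ℝ => s ^ 2 :=
    (((Complex.exp_sub_sum_range_isBigO_pow 3).comp_tendsto hz0).trans
      (hzO.pow 3)).trans_isLittleO (Asymptotics.isLittleO_pow_pow (by norm_num))
  refine ((h1.add (hc (α * β) 3 (by norm_num))).add (hc (β ^ 2 / 2) 4 (by norm_num))).congr_left
    fun s => ?_
  simp only [hz, Finset.sum_range_succ, Finset.sum_range_zero]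
  norm_num
  ring

namespace ArrowGraph

variable {Q A : Type*} [Fintype Q] [DecidableEq Q] [Fintype A] [DecidableEq A]
  {G : ArrowGraph Q A} {p : A → ℝ} {π : Q → ℝ} {x : EuclideanSpace ℝ A}

namespace IsMarkov

/-- Errors of an approximate eigenfunction add up at most linearly: the walk operator is a
contraction and `|ρ| ≤ 1`. -/
theorem norm_walkOp_pow_sub_smul_le (hM : G.IsMarkov p π) {V : Type*} [NormedAddCommGroup V]
    [NormedSpace ℝ V] {F : Q → EuclideanSpace ℝ A → V} {c ρ : ℝ} (hρ : |ρ| ≤ 1)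
    (h : ∀ q y, ‖G.walkOp p x V F q y - ρ • F q y‖ ≤ c) (n : ℕ) (q : Q)
    (y : EuclideanSpace ℝ A) :
    ‖(G.walkOp p x V ^ n) F q y - ρ ^ n • F q y‖ ≤ n * c := by
  induction n with
  | zero => simp
  | succ n ih =>
    have h1 : (G.walkOp p x V ^ (n + 1)) F q y - ρ ^ (n + 1) • F q y =
        (G.walkOp p x V ^ n) (G.walkOp p x V F - ρ • F) q y +
          ρ • ((G.walkOp p x V ^ n) F q y - ρ ^ n • F q y) := by
      rw [map_sub, map_smul, pow_succ, Module.End.mul_apply, pow_succ']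
      simp only [Pi.sub_apply, Pi.smul_apply]
      module
    rw [h1]
    refine (norm_add_le _ _).trans ?_
    have h2 := hM.norm_walkOp_pow_le (x := x) (F := G.walkOp p x V F - ρ • F) h n q y
    have h3 : ‖ρ • ((G.walkOp p x V ^ n) F q y - ρ ^ n • F q y)‖ ≤ n * c := by
      rw [norm_smul, Real.norm_eq_abs]
      exact (mul_le_of_le_one_left (norm_nonneg _) hρ).trans ih
    push_cast
    linarith

/-- Convergence of the characteristic functions in the central limit theorem. -/
theorem tendsto_walkOp_pow_exp (hM : G.IsMarkov p π) (hG : G.Connected)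
    {t : EuclideanSpace ℝ A} {h : A → ℝ} {u : Q → ℝ}
    (hh : ∀ a, h a = ⟪increment x a, t⟫ + (u (G.goal a) - u (G.source a)))
    (h0 : ∀ q, ∑ a with G.source a = q, p a * h a = 0) (q : Q) :
    Tendsto (fun n : ℕ => (G.walkOp p x ℂ ^ n)
        (fun _ y => Complex.exp ((√(n : ℝ))⁻¹ * (⟪y, t⟫ * Complex.I))) q 0) atTop
      (𝓝 (Real.exp (-(∑ a, π (G.source a) * (p a * h a ^ 2)) / 2) : ℝ)) := by
  obtain ⟨K, hK⟩ := hM.exists_corrector hG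
  set σ := ∑ a, π (G.source a) * (p a * h a ^ 2) with hσ
  have hσ0 : 0 ≤ σ := Finset.sum_nonneg fun a _ =>
    mul_nonneg (hM.stat_pos _).le (mul_nonneg (hM.pos a).le (sq_nonneg _))
  -- This second corrector makes the conditional variances equal to their stationary mean `σ`.
  set v := K fun a => h a ^ 2 with hv
  have hv0 : ∀ q, ∑ a with G.source a = q,
      p a * (h a ^ 2 + (v (G.goal a) - v (G.source a))) = σ := hK fun a => h a ^ 2
  -- The correctors `u` and `v` enter at orders `s` and `s²`, so that the one-step mean factor
  -- agrees at every state with `exp(-s²σ/2)` up to `o(s²)`.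
  set F : ℝ → Q → EuclideanSpace ℝ A → ℂ := fun s q y =>
    Complex.exp (s * (⟪y, t⟫ * Complex.I) + (s * (u q * Complex.I) + s ^ 2 * (-v q / 2))) with hF
  set α : A → ℂ := fun a => h a * Complex.I with hα
  set β : A → ℂ := fun a => (-((v (G.goal a) - v (G.source a) : ℝ) : ℂ) / 2) with hβ
  -- The term `s * 0` gives the eigenvalue the form of `Complex.exp_sub_quadratic_isLittleO` with
  -- zero linear coefficient.
  set e : ℝ → Q → ℂ := fun s q => ∑ a with G.source a = q,
    (p a : ℂ) * Complex.exp (s * α a + s ^ 2 * β a) - Complex.exp (s * 0 + s ^ 2 * (-σ / 2)) with he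
  have he_small : ∀ q, (fun s : ℝ => e s q) =o[𝓝 0] fun s : ℝ => s ^ 2 := by
    intro q
    have h1 : (fun s : ℝ => ∑ a with G.source a = q, (p a : ℂ) * (Complex.exp (s * α a + s ^ 2 * β a)
        - (1 + s * α a + s ^ 2 * (β a + α a ^ 2 / 2)))) =o[𝓝 0] fun s : ℝ => s ^ 2 := by
      refine Asymptotics.IsLittleO.congr_left (Asymptotics.IsLittleO.sum
        (s := Finset.univ.filter fun a => G.source a = q) fun a _ =>
          (Complex.exp_sub_quadratic_isLittleO (α a) (β a)).const_mul_left (p a : ℂ)) fun s => ?_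
      rw [Finset.sum_apply]
    refine (h1.sub (Complex.exp_sub_quadratic_isLittleO 0 (-σ / 2))).congr_left fun s => ?_
    have hp : (∑ a with G.source a = q, (p a : ℂ)) = 1 := by
      exact_mod_cast congrArg ((↑) : ℝ → ℂ) (hM.sum_eq_one q)
    have hp1 : (∑ a with G.source a = q, (p a : ℂ) * h a) = 0 := by
      exact_mod_cast congrArg ((↑) : ℝ → ℂ) (h0 q)
    have hp2 : (∑ a with G.source a = q,
        (p a : ℂ) * ((h a : ℂ) ^ 2 + (v (G.goal a) - v (G.source a)))) = σ := by
      exact_mod_cast congrArg ((↑) : ℝ → ℂ) (hv0 q)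
    have hmean : ∑ a with G.source a = q,
        (p a : ℂ) * (1 + s * α a + s ^ 2 * (β a + α a ^ 2 / 2)) = 1 + (s : ℂ) ^ 2 * (-σ / 2) := by
      calc _ = (∑ a with G.source a = q, (p a : ℂ)) +
            s * Complex.I * (∑ a with G.source a = q, (p a : ℂ) * h a) +
            s ^ 2 * (-(∑ a with G.source a = q,
              (p a : ℂ) * ((h a : ℂ) ^ 2 + (v (G.goal a) - v (G.source a)))) / 2) := by
            rw [Finset.mul_sum, ← Finset.sum_neg_distrib, Finset.sum_div, Finset.mul_sum,
              ← Finset.sum_add_distrib, ← Finset.sum_add_distrib]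
            refine Finset.sum_congr rfl fun a _ => ?_
            simp only [hα, hβ]
            push_cast
            linear_combination (p a : ℂ) * s ^ 2 * h a ^ 2 / 2 * Complex.I_sq
        _ = _ := by rw [hp, hp1, hp2]; ring
    simp only [mul_sub, Finset.sum_sub_distrib, hmean, he]
    ring
  have hstep : ∀ s q y, G.walkOp p x ℂ (F s) q y - Real.exp (-(s ^ 2 * σ / 2)) • F s q y =
      e s q * F s q y := by
    intro s q y
    rw [walkOp_apply]
    simp only [hF, he, sub_mul, Finset.sum_mul]
    congr 1
    · refine Finset.sum_congr rfl fun a ha => ?_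
      rw [Complex.real_smul, mul_assoc, ← Complex.exp_add]
      congr 2
      simp only [hα, hβ, hh, (Finset.mem_filter.1 ha).2, inner_add_left]
      push_cast
      ring
    · rw [Complex.real_smul, Complex.ofReal_exp]
      congr 2
      push_cast
      ring
  have hFnorm : ∀ s q y, |s| ≤ 1 → ‖F s q y‖ ≤ Real.exp ‖v‖ := by
    intro s q y hs
    rw [Complex.norm_exp, Real.exp_le_exp]
    have h1 : ((s : ℂ) * (⟪y, t⟫ * Complex.I) + (s * (u q * Complex.I) + s ^ 2 * (-v q / 2))).re =
        s ^ 2 * (-v q / 2) := by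
      have : (s : ℂ) * (⟪y, t⟫ * Complex.I) + (s * (u q * Complex.I) + s ^ 2 * (-v q / 2)) =
        ((s ^ 2 * (-v q / 2) : ℝ) : ℂ) + ((s * ⟪y, t⟫ + s * u q : ℝ) : ℂ) * Complex.I := by
        push_cast
        ring
      rw [this, Complex.add_re, Complex.ofReal_re, Complex.re_ofReal_mul, Complex.I_re, mul_zero,
        add_zero]
    rw [h1]
    have h2 : |v q| ≤ ‖v‖ := norm_le_pi_norm v q
    have h3 : s ^ 2 ≤ 1 := by rw [← sq_abs]; exact pow_le_one₀ (abs_nonneg _) hs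
    calc s ^ 2 * (-v q / 2) ≤ s ^ 2 * ‖v‖ := by
          gcongr
          linarith [neg_le_abs (v q), abs_nonneg (v q)]
      _ ≤ _ := mul_le_of_le_one_left (norm_nonneg _) h3
  set c : ℝ → Q → ℂ := fun s q => Complex.exp (s * (u q * Complex.I) + s ^ 2 * (-v q / 2)) with hc
  have hFc : ∀ s q y, F s q y = Complex.exp (s * (⟪y, t⟫ * Complex.I)) * c s q :=
    fun s q y => Complex.exp_add _ _
  have hc1 : ∀ q, Tendsto (fun s => c s q) (𝓝 0) (𝓝 1) := by
    intro q
    have : Continuous fun s => c s q := by fun_prop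
    simpa [hc] using this.tendsto 0
  have hs0 : Tendsto (fun n : ℕ => (√(n : ℝ))⁻¹) atTop (𝓝 0) :=
    (Real.tendsto_sqrt_atTop.comp tendsto_natCast_atTop_atTop).inv_tendsto_atTop
  -- The first term is the cost of inserting the correctors, the second that of `n` approximate
  -- eigenvalue steps; at `s = 1/√n` the latter is `n · o(1/n)`.
  set b : ℕ → ℝ := fun n => ∑ q, ‖c (√(n : ℝ))⁻¹ q - 1‖ +
    n * (∑ q, ‖e (√(n : ℝ))⁻¹ q‖ * Real.exp ‖v‖) with hb
  have hb0 : Tendsto b atTop (𝓝 0) := by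
    have h1 : Tendsto (fun n : ℕ => ∑ q, ‖c (√(n : ℝ))⁻¹ q - 1‖) atTop (𝓝 (∑ _q : Q, 0)) := by
      refine tendsto_finsetSum _ fun q _ => ?_
      have := (((hc1 q).comp hs0).sub_const 1).norm
      simpa using this
    have h2 : Tendsto (fun n : ℕ => ∑ q, (n : ℝ) * ‖e (√(n : ℝ))⁻¹ q‖ * Real.exp ‖v‖) atTop
        (𝓝 (∑ _q : Q, 0 * Real.exp ‖v‖)) := by
      refine tendsto_finsetSum _ fun q _ => Tendsto.mul_const _ ?_
      have := ((he_small q).norm_left.comp_tendsto hs0).tendsto_div_nhds_zero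
      refine this.congr fun n => ?_
      simp only [Function.comp_apply, inv_pow, Real.sq_sqrt (Nat.cast_nonneg n)]
      rw [div_inv_eq_mul, mul_comm]
    have h3 := h1.add h2
    simp only [Finset.sum_const_zero, zero_mul, add_zero] at h3
    refine h3.congr fun n => ?_
    simp only [hb, Finset.mul_sum, mul_assoc]
  have hbound : ∀ n : ℕ, 1 ≤ n → ‖(G.walkOp p x ℂ ^ n)
      (fun _ y => Complex.exp ((√(n : ℝ))⁻¹ * (⟪y, t⟫ * Complex.I))) q 0 -
        Real.exp (-σ / 2) • c (√(n : ℝ))⁻¹ q‖ ≤ b n := by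
    intro n hn
    have hn1 : (1 : ℝ) ≤ n := by exact_mod_cast hn
    set s := (√(n : ℝ))⁻¹ with hs
    have hspos : 0 ≤ s := by positivity
    have hs1 : |s| ≤ 1 := by
      rw [abs_of_nonneg hspos]
      exact inv_le_one_of_one_le₀ (Real.one_le_sqrt.2 hn1)
    have h1 := hM.norm_walkOp_pow_sub_le (x := x)
      (F := fun _ y => Complex.exp (s * (⟪y, t⟫ * Complex.I))) (F' := F s)
      (c := ∑ q, ‖c s q - 1‖) (fun q' y => by
        rw [hFc, ← mul_one_sub, norm_mul, norm_sub_rev]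
        have : ‖Complex.exp (s * (⟪y, t⟫ * Complex.I))‖ = 1 := by
          rw [← mul_assoc, ← Complex.ofReal_mul, Complex.norm_exp_ofReal_mul_I]
        rw [this, one_mul]
        exact Finset.single_le_sum (f := fun q => ‖c s q - 1‖) (fun _ _ => norm_nonneg _)
          (Finset.mem_univ q')) n q 0
    have h2 := hM.norm_walkOp_pow_sub_smul_le (x := x) (F := F s)
      (ρ := Real.exp (-(s ^ 2 * σ / 2))) (c := ∑ q, ‖e s q‖ * Real.exp ‖v‖) (by
        rw [abs_of_pos (Real.exp_pos _), Real.exp_le_one_iff]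
        have : 0 ≤ s ^ 2 * σ / 2 := by positivity
        linarith) (fun q' y => by
        rw [hstep, norm_mul]
        exact (mul_le_mul_of_nonneg_left (hFnorm s q' y hs1) (norm_nonneg _)).trans
          (Finset.single_le_sum (f := fun q => ‖e s q‖ * Real.exp ‖v‖)
          (fun _ _ => by positivity) (Finset.mem_univ q'))) n q 0
    have h3 : Real.exp (-(s ^ 2 * σ / 2)) ^ n = Real.exp (-σ / 2) := by
      rw [← Real.exp_nat_mul, hs, inv_pow, Real.sq_sqrt (Nat.cast_nonneg n)]
      congr 1
      field_simp
    have h4 : F s q 0 = c s q := by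
      rw [hFc]
      simp
    rw [h3, h4] at h2
    exact (norm_sub_le_norm_sub_add_norm_sub _ _ _).trans (add_le_add h1 h2)
  have hlim1 := squeeze_zero_norm' (eventually_atTop.2 ⟨1, hbound⟩) hb0
  have hlim2 := (((hc1 q).comp hs0).const_smul (Real.exp (-σ / 2)))
  have := hlim1.add hlim2
  simp only [Function.comp_apply, sub_add_cancel, zero_add] at this
  simpa using this

end IsMarkov

end ArrowGraph

/-! ### Central limit theorem and asymptotic independence of the final state. -/

namespace ArrowGraph

variable {Q A : Type*} [Fintype Q] [DecidableEq Q] [Fintype A] [DecidableEq A]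

/-- The law of the centered letter count of the Markov chain started at `q`, after `n` steps. -/
noncomputable def walkLaw (G : ArrowGraph Q A) (p : A → ℝ) (x : EuclideanSpace ℝ A) :
    ℕ → Q → Measure (EuclideanSpace ℝ A)
  | 0, _ => Measure.dirac 0
  | n + 1, q => ∑ a with G.source a = q, ENNReal.ofReal (p a) •
      (walkLaw G p x n (G.goal a)).map (· + increment x a)

/-- The mean of `ψ` for the equilibrium of the cyclic class reached from `q` in `n` steps. -/
noncomputable def cyclicMean (G : ArrowGraph Q A) (π ψ : Q → ℝ) (n : ℕ) (q : Q) : ℝ :=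
  G.period q * ∑ q' ∈ G.cyclicClass q n, π q' * ψ q'

variable {G : ArrowGraph Q A} {p : A → ℝ} {π : Q → ℝ} {x : EuclideanSpace ℝ A}

theorem Connected.cyclicMean_goal (hG : G.Connected) (ψ : Q → ℝ) (n : ℕ) (a : A) :
    G.cyclicMean π ψ n (G.goal a) = G.cyclicMean π ψ (n + 1) (G.source a) := by
  rw [cyclicMean, cyclicMean, hG.cyclicClass_goal, hG.period_eq (G.goal a) (G.source a)]

/-- Cyclic classes advance deterministically along arrows, so the cyclic mean depends only on the
starting state and the time and leaves the expectation. -/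
theorem Connected.walkOp_pow_cyclicMean_mul (hG : G.Connected) (ψ : Q → ℝ)
    (F : EuclideanSpace ℝ A → ℝ) (k m : ℕ) (q : Q) (y : EuclideanSpace ℝ A) :
    (G.walkOp p x ℝ ^ m) (fun q y => G.cyclicMean π ψ k q * F y) q y =
      G.cyclicMean π ψ (k + m) q * (G.walkOp p x ℝ ^ m) (fun _ y => F y) q y := by
  induction m generalizing q y with
  | zero => rfl
  | succ m ih =>
    rw [walkOp_pow_succ, walkOp_pow_succ, Finset.mul_sum]
    refine Finset.sum_congr rfl fun a ha => ?_
    rw [ih, hG.cyclicMean_goal, (Finset.mem_filter.1 ha).2, smul_eq_mul, smul_eq_mul, add_assoc]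
    ring

namespace IsMarkov

theorem isProbabilityMeasure_walkLaw (hM : G.IsMarkov p π) (n : ℕ) (q : Q) :
    IsProbabilityMeasure (G.walkLaw p x n q) := by
  induction n generalizing q with
  | zero => exact Measure.dirac.isProbabilityMeasure
  | succ n ih =>
    refine ⟨?_⟩
    rw [walkLaw, Measure.finsetSum_apply]
    have : ∀ a, (ENNReal.ofReal (p a) • (G.walkLaw p x n (G.goal a)).map (· + increment x a))
        Set.univ = ENNReal.ofReal (p a) := by
      intro a
      have := ih (G.goal a)
      rw [Measure.smul_apply, Measure.map_apply (by fun_prop) MeasurableSet.univ, Set.preimage_univ,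
        measure_univ, smul_eq_mul, mul_one]
    simp only [this]
    rw [← ENNReal.ofReal_sum_of_nonneg fun a _ => (hM.pos a).le, hM.sum_eq_one, ENNReal.ofReal_one]

theorem integrable_walkLaw {V : Type*} [NormedAddCommGroup V]
    {g : EuclideanSpace ℝ A → V} (hg : Continuous g) (n : ℕ) (q : Q) :
    Integrable g (G.walkLaw p x n q) := by
  induction n generalizing q g with
  | zero => exact integrable_dirac (by simp)
  | succ n ih =>
    rw [walkLaw, integrable_finsetSum_measure]
    intro a _
    refine Integrable.smul_measure ?_ ENNReal.ofReal_ne_top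
    rw [integrable_map_measure hg.aestronglyMeasurable (by fun_prop)]
    exact ih (hg.comp (continuous_id.add continuous_const)) _

/-- The bridge from operators to measures, needed to invoke Lévy's continuity theorem. -/
theorem integral_walkLaw (hM : G.IsMarkov p π) {V : Type*} [NormedAddCommGroup V]
    [NormedSpace ℝ V] [CompleteSpace V] {g : EuclideanSpace ℝ A → V} (hg : Continuous g) (n : ℕ)
    (q : Q) (y : EuclideanSpace ℝ A) :
    ∫ z, g (y + z) ∂(G.walkLaw p x n q) = (G.walkOp p x V ^ n) (fun _ y => g y) q y := by
  induction n generalizing q y with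
  | zero =>
    rw [walkLaw, integral_dirac, add_zero]
    rfl
  | succ n ih =>
    have hg' : Continuous fun z => g (y + z) := hg.comp (continuous_const.add continuous_id)
    rw [walkLaw, integral_finsetSum_measure, walkOp_pow_succ]
    · refine Finset.sum_congr rfl fun a _ => ?_
      rw [integral_smul_measure, ENNReal.toReal_ofReal (hM.pos a).le,
        integral_map (by fun_prop) hg'.aestronglyMeasurable, ← ih]
      congr 2
      ext z
      congr 1
      abel
    · intro a _
      refine Integrable.smul_measure ?_ ENNReal.ofReal_ne_top
      rw [integrable_map_measure hg'.aestronglyMeasurable (by fun_prop)]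
      exact integrable_walkLaw (hg'.comp (continuous_id.add continuous_const)) _ _

/-- The central limit theorem for the walk. -/
theorem tendsto_walkOp_pow_comp (hM : G.IsMarkov p π) (hG : G.Connected)
    {H : EuclideanSpace ℝ A → A → ℝ} {U : EuclideanSpace ℝ A → Q → ℝ}
    (hH : ∀ t a, H t a = ⟪increment x a, t⟫ + (U t (G.goal a) - U t (G.source a)))
    (hH0 : ∀ t q, ∑ a with G.source a = q, p a * H t a = 0)
    (ν : Measure (EuclideanSpace ℝ A)) [IsProbabilityMeasure ν]
    (hν : ∀ t, charFun ν t = (Real.exp (-(∑ a, π (G.source a) * (p a * H t a ^ 2)) / 2) : ℝ))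
    {g : EuclideanSpace ℝ A → ℝ} (hg : Continuous g) {C : ℝ} (hC : ∀ y, ‖g y‖ ≤ C) (q : Q) :
    Tendsto (fun n : ℕ => (G.walkOp p x ℝ ^ n) (fun _ y => g ((√(n : ℝ))⁻¹ • y)) q 0) atTop
      (𝓝 (∫ y, g y ∂ν)) := by
  have hprob := fun n => hM.isProbabilityMeasure_walkLaw (x := x) n q
  have hsm : ∀ s : ℝ, Measurable fun y : EuclideanSpace ℝ A => s • y := fun s => by fun_prop
  have hprob' : ∀ n : ℕ, IsProbabilityMeasure
      ((G.walkLaw p x n q).map fun y => (√(n : ℝ))⁻¹ • y) := fun n =>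
    Measure.isProbabilityMeasure_map (hsm _).aemeasurable
  let μ : ℕ → ProbabilityMeasure (EuclideanSpace ℝ A) := fun n =>
    ⟨(G.walkLaw p x n q).map fun y => (√(n : ℝ))⁻¹ • y, hprob' n⟩
  have hlim : Tendsto μ atTop (𝓝 ⟨ν, inferInstance⟩) := by
    refine ProbabilityMeasure.tendsto_of_tendsto_charFun fun t => ?_
    rw [ProbabilityMeasure.coe_mk, hν]
    refine (hM.tendsto_walkOp_pow_exp hG (hH t) (hH0 t) q).congr fun n => ?_
    have hcont : Continuous fun y : EuclideanSpace ℝ A =>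
        Complex.exp ((√(n : ℝ))⁻¹ * (⟪y, t⟫ * Complex.I)) := by fun_prop
    rw [← hM.integral_walkLaw hcont, ProbabilityMeasure.coe_mk, charFun_apply,
      integral_map (hsm _).aemeasurable (by fun_prop)]
    refine integral_congr_ae (Eventually.of_forall fun y => ?_)
    simp only [zero_add, inner_smul_left, conj_trivial]
    push_cast
    rw [mul_assoc]
  have := (ProbabilityMeasure.tendsto_iff_forall_integral_tendsto.1 hlim)
    (BoundedContinuousFunction.ofNormedAddCommGroup g hg C hC)
  simp only [ProbabilityMeasure.coe_mk, BoundedContinuousFunction.coe_ofNormedAddCommGroup] at this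
  refine this.congr fun n => ?_
  have hcont : Continuous fun y : EuclideanSpace ℝ A => g ((√(n : ℝ))⁻¹ • y) := by fun_prop
  rw [← hM.integral_walkLaw hcont]
  simp only [μ, ProbabilityMeasure.coe_mk]
  rw [integral_map (hsm _).aemeasurable hg.aestronglyMeasurable]
  simp only [zero_add]

/-- In `n` steps the walk moves by at most `n * C`, so `F` can be frozen at `y₀`, leaving an
expectation for the chain of states alone. -/
theorem abs_walkOp_pow_mul_sub_le (hM : G.IsMarkov p π) {C : ℝ} (hC : ∀ a, ‖increment x a‖ ≤ C)
    (ψ : Q → ℝ) {F : EuclideanSpace ℝ A → ℝ} {r ω : ℝ} {y₀ : EuclideanSpace ℝ A}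
    (hF : ∀ y, ‖y - y₀‖ ≤ r → |F y - F y₀| ≤ ω) (n : ℕ) (q : Q) {y : EuclideanSpace ℝ A}
    (hy : ‖y - y₀‖ + n * C ≤ r) :
    |(G.walkOp p x ℝ ^ n) (fun q y => ψ q * F y) q y - (G.markovOp p ^ n) ψ q * F y₀| ≤
      ‖ψ‖ * ω := by
  induction n generalizing q y with
  | zero =>
    simp only [pow_zero, Module.End.one_apply, ← mul_sub, abs_mul]
    have h1 := hF y (by simpa using hy)
    exact mul_le_mul (norm_le_pi_norm ψ q) h1 (abs_nonneg _) (norm_nonneg _)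
  | succ n ih =>
    rw [walkOp_pow_succ, markovOp_pow_succ, Finset.sum_mul, ← Finset.sum_sub_distrib,
      ← hM.mean_const (‖ψ‖ * ω) q]
    refine (Finset.abs_sum_le_sum_abs _ _).trans (Finset.sum_le_sum fun a _ => ?_)
    rw [smul_eq_mul, mul_assoc, ← mul_sub, abs_mul, abs_of_pos (hM.pos a)]
    refine mul_le_mul_of_nonneg_left (ih _ ?_) (hM.pos a).le
    have h1 : ‖y + increment x a - y₀‖ ≤ ‖y - y₀‖ + C := by
      rw [add_sub_right_comm]
      exact (norm_add_le _ _).trans (by gcongr; exact hC a)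
    push_cast at hy
    linarith

theorem abs_cyclicMean_le (hM : G.IsMarkov p π) (hG : G.Connected) (ψ : Q → ℝ) (n : ℕ) (q : Q) :
    |G.cyclicMean π ψ n q| ≤ ‖ψ‖ := by
  rw [cyclicMean, abs_mul, Nat.abs_cast]
  calc (G.period q : ℝ) * |∑ q' ∈ G.cyclicClass q n, π q' * ψ q'|
      ≤ G.period q * ∑ q' ∈ G.cyclicClass q n, π q' * ‖ψ‖ := by
        gcongr
        refine (Finset.abs_sum_le_sum_abs _ _).trans (Finset.sum_le_sum fun q' _ => ?_)
        rw [abs_mul, abs_of_pos (hM.stat_pos q')]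
        exact mul_le_mul_of_nonneg_left (norm_le_pi_norm ψ q') (hM.stat_pos q').le
    _ = ‖ψ‖ := by
      rw [← Finset.sum_mul, ← mul_assoc, hM.period_mul_sum_cyclicClass hG, one_mul]

/-- Asymptotic independence of the normalized letter count and of the final state, given the
cyclic class of the latter. -/
theorem tendsto_walkOp_pow_mul_sub (hM : G.IsMarkov p π) (hG : G.Connected) (ψ : Q → ℝ)
    {g : EuclideanSpace ℝ A → ℝ} (hg : UniformContinuous g) {C : ℝ} (hC : ∀ y, ‖g y‖ ≤ C) (q : Q) :
    Tendsto (fun n : ℕ => (G.walkOp p x ℝ ^ n) (fun q y => ψ q * g ((√(n : ℝ))⁻¹ • y)) q 0 -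
      G.cyclicMean π ψ n q * (G.walkOp p x ℝ ^ n) (fun _ y => g ((√(n : ℝ))⁻¹ • y)) q 0) atTop
      (𝓝 0) := by
  have hC0 : 0 ≤ C := (norm_nonneg _).trans (hC 0)
  rw [Metric.tendsto_atTop]
  intro η hη
  -- The errors below total `(2‖ψ‖ + C) ε`; the extra `1` gives strict inequality and a positive
  -- denominator.
  set ε := η / (2 * ‖ψ‖ + C + 1) with hε
  have hden : 0 < 2 * ‖ψ‖ + C + 1 := by positivity
  have hε0 : 0 < ε := div_pos hη hden
  obtain ⟨k, hk⟩ : ∃ k, ∀ q, |(G.markovOp p ^ k) ψ q - G.cyclicMean π ψ k q| ≤ ε := by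
    have h : ∀ᶠ k in atTop, ∀ q, |(G.markovOp p ^ k) ψ q - G.cyclicMean π ψ k q| < ε := by
      rw [eventually_all]
      intro q
      have := (hM.tendsto_markovOp_pow hG ψ q).norm.eventually_lt_const (u := ε) (by simpa using hε0)
      exact this
    exact h.exists.imp fun k hk q => (hk q).le
  set D := ∑ a, ‖increment x a‖ with hD
  have hDa : ∀ a, ‖increment x a‖ ≤ D := fun a =>
    Finset.single_le_sum (f := fun a => ‖increment x a‖) (fun _ _ => norm_nonneg _)
      (Finset.mem_univ a)
  obtain ⟨δ, hδ, hgδ⟩ := Metric.uniformContinuous_iff.1 hg ε hε0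
  have hs0 : Tendsto (fun n : ℕ => (√(n : ℝ))⁻¹ * (k * D)) atTop (𝓝 0) := by
    rw [← zero_mul (k * D)]
    exact (Real.tendsto_sqrt_atTop.comp tendsto_natCast_atTop_atTop).inv_tendsto_atTop.mul_const _
  obtain ⟨N, hN⟩ := eventually_atTop.1 (hs0.eventually_lt_const hδ)
  refine ⟨max N k, fun n hn => ?_⟩
  -- The first `m` steps determine the position up to a negligible error, and the last `k` steps
  -- equilibrate the state; `k` is fixed while `n` grows.
  obtain ⟨m, rfl⟩ : ∃ m, n = m + k := ⟨n - k, by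
    rw [Nat.sub_add_cancel ((le_max_right _ _).trans hn)]⟩
  have hsn := hN (m + k) ((le_max_left _ _).trans hn)
  set s := (√((m + k : ℕ) : ℝ))⁻¹ with hs
  have hs_nonneg : 0 ≤ s := by positivity
  have hF : ∀ y₀ y : EuclideanSpace ℝ A, ‖y - y₀‖ ≤ k * D → |g (s • y) - g (s • y₀)| ≤ ε := by
    intro y₀ y hy
    refine (hgδ ?_).le
    rw [dist_eq_norm, ← smul_sub, norm_smul, Real.norm_of_nonneg hs_nonneg]
    exact (mul_le_mul_of_nonneg_left hy hs_nonneg).trans_lt hsn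
  have key : ∀ (χ : Q → ℝ) q y, |(G.walkOp p x ℝ ^ k) (fun q y => χ q * g (s • y)) q y -
      (G.markovOp p ^ k) χ q * g (s • y)| ≤ ‖χ‖ * ε := fun χ q y =>
    hM.abs_walkOp_pow_mul_sub_le hDa χ (F := fun y => g (s • y)) (hF y) k q (by simp)
  have h1 : |(G.walkOp p x ℝ ^ (m + k)) (fun q y => ψ q * g (s • y)) q 0 -
      G.cyclicMean π ψ (m + k) q * (G.walkOp p x ℝ ^ m) (fun _ y => g (s • y)) q 0| ≤
        (‖ψ‖ + C) * ε := by
    rw [add_comm m k, ← hG.walkOp_pow_cyclicMean_mul, add_comm k m, pow_add, Module.End.mul_apply,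
      ← Real.norm_eq_abs]
    refine hM.norm_walkOp_pow_sub_le (V := ℝ) (fun q y => ?_) m q 0
    refine (norm_sub_le_norm_sub_add_norm_sub _ ((G.markovOp p ^ k) ψ q * g (s • y)) _).trans ?_
    rw [add_mul]
    refine add_le_add (key ψ q y) ?_
    rw [← sub_mul, norm_mul, mul_comm C]
    exact mul_le_mul (hk q) (hC _) (norm_nonneg _) hε0.le
  have h2 : |(G.walkOp p x ℝ ^ (m + k)) (fun _ y => g (s • y)) q 0 -
      (G.walkOp p x ℝ ^ m) (fun _ y => g (s • y)) q 0| ≤ ε := by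
    rw [pow_add, Module.End.mul_apply,
      ← Real.norm_eq_abs]
    refine hM.norm_walkOp_pow_sub_le (V := ℝ) (fun q y => ?_) m q 0
    have h3 := key (fun _ => 1) q y
    rw [hM.markovOp_pow_const] at h3
    simp only [one_mul] at h3
    have : Nonempty Q := ⟨q⟩
    refine h3.trans (mul_le_of_le_one_left hε0.le ?_)
    rw [pi_norm_const, norm_one]
  rw [Real.dist_eq, sub_zero]
  calc _ ≤ _ + _ := abs_sub_le _
          (G.cyclicMean π ψ (m + k) q * (G.walkOp p x ℝ ^ m) (fun _ y => g (s • y)) q 0) _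
    _ ≤ (‖ψ‖ + C) * ε + ‖ψ‖ * ε := by
        refine add_le_add h1 ?_
        rw [← mul_sub, abs_mul, abs_sub_comm]
        exact mul_le_mul (hM.abs_cyclicMean_le hG ψ _ q) h2 (abs_nonneg _) (norm_nonneg _)
    _ < (2 * ‖ψ‖ + C + 1) * ε := by linarith
    _ = η := by rw [hε, mul_div_cancel₀ _ hden.ne']

end IsMarkov

end ArrowGraph

/-! ### Gaussian measures and dual quadratic forms. -/

namespace QuadraticForm

variable {H : Type*} [NormedAddCommGroup H] [NormedSpace ℝ H]

theorem IsOrthonormalBasis.apply_eq_sum_sq {ι : Type*} [DecidableEq ι] [Fintype ι]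
    {χ : QuadraticForm ℝ H} {b : Module.Basis ι ℝ H} (hb : IsOrthonormalBasis χ b) (v : H) :
    χ v = ∑ i, b.repr v i ^ 2 := by
  rw [← QuadraticMap.associated_eq_self_apply ℝ χ v]
  conv_lhs => rw [← b.sum_repr v]
  simp only [map_sum, map_smul, LinearMap.sum_apply, LinearMap.smul_apply, smul_eq_mul, hb _ _,
    mul_ite, mul_one, mul_zero, Finset.sum_ite_eq', Finset.mem_univ, if_true, sq]

theorem exists_posDef_isOrthonormalBasis {ι : Type*} [DecidableEq ι] [Fintype ι]
    (b : Module.Basis ι ℝ H) :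
    ∃ χ : QuadraticForm ℝ H, χ.PosDef ∧ IsOrthonormalBasis χ b := by
  let χ : QuadraticForm ℝ H :=
    (QuadraticMap.weightedSumSquares ℝ fun _ : ι => (1 : ℝ)).comp b.equivFun.toLinearMap
  have hχ : ∀ v, χ v = ∑ i, b.repr v i * b.repr v i := fun v => by
    simp [χ, QuadraticMap.weightedSumSquares_apply]
  refine ⟨χ, fun v hv => ?_, fun i j => ?_⟩
  · rw [hχ]
    refine lt_of_le_of_ne (Finset.sum_nonneg fun i _ => mul_self_nonneg _) fun h => hv ?_
    have := (Finset.sum_eq_zero_iff_of_nonneg fun i _ => mul_self_nonneg _).1 h.symm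
    refine b.repr.map_eq_zero_iff.1 (Finsupp.ext fun i => ?_)
    exact mul_self_eq_zero.1 (this i (Finset.mem_univ i))
  · rw [QuadraticMap.associated_apply]
    have h1 : χ (b i + b j) - χ (b i) - χ (b j) = 2 * if i = j then 1 else 0 := by
      rw [hχ, hχ, hχ, ← Finset.sum_sub_distrib, ← Finset.sum_sub_distrib,
        ← Fintype.sum_ite_eq i fun _ => (2 * if i = j then (1 : ℝ) else 0)]
      refine Finset.sum_congr rfl fun k _ => ?_
      simp only [map_add, Finsupp.add_apply, Module.Basis.repr_self, Finsupp.single_apply]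
      split_ifs <;> simp_all; norm_num
    rw [h1]
    simp

variable [FiniteDimensional ℝ H] [MeasurableSpace H] [BorelSpace H]

theorem integral_addHaar_basis {ι : Type*} [Fintype ι] (b : Module.Basis ι ℝ H) (h : H → ℝ) :
    ∫ y, h y ∂b.addHaar = ∫ z : ι → ℝ, h (∑ i, z i • b i) := by
  have hmap : b.addHaar = (volume : Measure (ι → ℝ)).map b.equivFun.symm.toContinuousLinearEquiv := by
    rw [← addHaarMeasure_eq_volume_pi, ← Module.Basis.parallelepiped_basisFun,
      ← Module.Basis.addHaar_def, Module.Basis.map_addHaar]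
    congr 1
    refine Module.Basis.eq_of_apply_eq fun i => ?_
    classical
    simp
  have hemb : MeasurableEmbedding b.equivFun.symm.toContinuousLinearEquiv :=
    b.equivFun.symm.toContinuousLinearEquiv.toHomeomorph.measurableEmbedding
  rw [hmap, hemb.integral_map]
  simp

end QuadraticForm

/-- The density of the standard Gaussian measure on `ℝ^ι`. -/
noncomputable def gaussianDensity {ι : Type*} [Fintype ι] (z : ι → ℝ) : ℝ :=
  ∏ i, ProbabilityTheory.gaussianPDFReal 0 1 (z i)

section

variable {ι : Type*} [Fintype ι]

theorem gaussianDensity_nonneg (z : ι → ℝ) : 0 ≤ gaussianDensity z :=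
  Finset.prod_nonneg fun _ _ => ProbabilityTheory.gaussianPDFReal_nonneg _ _ _

theorem measurable_gaussianDensity : Measurable (gaussianDensity (ι := ι)) :=
  Finset.measurable_fun_prod _ fun i _ =>
    (ProbabilityTheory.measurable_gaussianPDFReal 0 1).comp (measurable_pi_apply i)

theorem gaussianDensity_eq (z : ι → ℝ) : gaussianDensity z =
    ((2 * Real.pi) ^ ((Fintype.card ι : ℝ) / 2))⁻¹ * Real.exp (-(1 / 2) * ∑ i, z i ^ 2) := by
  have h0 : (0 : ℝ) ≤ 2 * Real.pi := by positivity
  simp only [gaussianDensity, ProbabilityTheory.gaussianPDFReal, Finset.prod_mul_distrib,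
    ← Real.exp_sum, Finset.prod_const, Finset.card_univ, NNReal.coe_one, mul_one, sub_zero,
    Finset.mul_sum, inv_pow, Real.sqrt_eq_rpow]
  rw [← Real.rpow_natCast, ← Real.rpow_mul h0]
  congr 3
  · ring
  · ext i
    ring

/-- The image of the standard Gaussian measure by the linear map sending the standard basis to
`b`. -/
noncomputable def gaussianOfVectors {E : Type*} [NormedAddCommGroup E] [NormedSpace ℝ E]
    [MeasurableSpace E] (b : ι → E) : Measure E :=
  (volume.withDensity fun z : ι → ℝ => ENNReal.ofReal (gaussianDensity z)).map fun z =>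
    ∑ i, z i • b i

variable {E : Type*} [NormedAddCommGroup E] [InnerProductSpace ℝ E]
  [MeasurableSpace E] [BorelSpace E]

theorem integral_gaussianOfVectors {V : Type*} [NormedAddCommGroup V] [NormedSpace ℝ V]
    (b : ι → E) {g : E → V} (hg : StronglyMeasurable g) :
    ∫ y, g y ∂gaussianOfVectors b = ∫ z : ι → ℝ, gaussianDensity z • g (∑ i, z i • b i) := by
  have hc : Continuous fun z : ι → ℝ => ∑ i, z i • b i := by fun_prop
  rw [gaussianOfVectors, integral_map hc.measurable.aemeasurable hg.aestronglyMeasurable,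
    integral_withDensity_eq_integral_toReal_smul measurable_gaussianDensity.ennreal_ofReal
      (Eventually.of_forall fun _ => ENNReal.ofReal_lt_top)]
  simp only [ENNReal.toReal_ofReal (gaussianDensity_nonneg _)]

/-- The integrand is a product over coordinates, so Fubini reduces to the standard real Gaussian.
The vectors need not span, which allows a measure carried by a subspace. -/
theorem charFun_gaussianOfVectors [SecondCountableTopology E] (b : ι → E) (t : E) :
    charFun (gaussianOfVectors b) t = (Real.exp (-(∑ i, ⟪b i, t⟫ ^ 2) / 2) : ℝ) := by
  have hc : Continuous fun y : E => Complex.exp (⟪y, t⟫ * Complex.I) := by fun_prop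
  rw [charFun_apply, integral_gaussianOfVectors _ hc.stronglyMeasurable]
  have h : ∀ z : ι → ℝ, gaussianDensity z • Complex.exp (⟪∑ i, z i • b i, t⟫ * Complex.I) =
      ∏ i, ProbabilityTheory.gaussianPDFReal 0 1 (z i) •
        Complex.exp (⟪b i, t⟫ * z i * Complex.I) := by
    intro z
    simp only [Complex.real_smul, Finset.prod_mul_distrib, gaussianDensity, Complex.ofReal_prod,
      ← Complex.exp_sum, sum_inner, inner_smul_left, conj_trivial, Complex.ofReal_sum,
      Complex.ofReal_mul, Finset.sum_mul, mul_comm (z _ : ℂ)]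
  simp only [h]
  rw [integral_fintype_prod_volume_eq_prod (fun i (x : ℝ) =>
    ProbabilityTheory.gaussianPDFReal 0 1 x • Complex.exp (⟪b i, t⟫ * x * Complex.I))]
  simp only [← ProbabilityTheory.integral_gaussianReal_eq_integral_smul one_ne_zero,
    ← charFun_apply_real, ProbabilityTheory.charFun_gaussianReal, ← Complex.exp_sum]
  push_cast
  rw [← Finset.sum_neg_distrib, Finset.sum_div]
  congr 1
  refine Finset.sum_congr rfl fun i _ => ?_
  simp [neg_div]

theorem isProbabilityMeasure_gaussianOfVectors [SecondCountableTopology E] (b : ι → E) :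
    IsProbabilityMeasure (gaussianOfVectors b) := by
  have h := charFun_gaussianOfVectors b 0
  rw [charFun_zero] at h
  have h1 : (gaussianOfVectors b).real Set.univ = 1 := by
    simpa using h
  refine ⟨?_⟩
  rw [measureReal_def] at h1
  rw [← ENNReal.ofReal_one, ← h1, ENNReal.ofReal_toReal]
  intro h2
  simp [h2] at h1

end

/-- The Gaussian measure on a subspace whose covariance is a given positive definite quadratic
form, in terms of the dual quadratic form. -/
theorem exists_gaussian_of_covariance {E : Type*} [NormedAddCommGroup E] [InnerProductSpace ℝ E]
    [FiniteDimensional ℝ E] [MeasurableSpace E] [BorelSpace E] (S : Submodule ℝ E)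
    (τ : QuadraticForm ℝ S) (hτ : τ.PosDef) :
    ∃ χ : QuadraticForm ℝ S, χ.PosDef ∧ ∃ ν : Measure E, IsProbabilityMeasure ν ∧
      (∀ s : S, ∀ t ∈ Sᗮ, charFun ν (s + t) = (Real.exp (-τ s / 2) : ℝ)) ∧
      ∀ g : E → ℝ, Continuous g → ∫ y, g y ∂ν =
        ((2 * Real.pi) ^ ((Module.finrank ℝ S : ℝ) / 2))⁻¹ *
          ∫ y : S, Real.exp (-(1 / 2) * χ y) * g y ∂QuadraticForm.lebesgue χ := by
  obtain ⟨c, hc⟩ := QuadraticForm.exists_isOrthonormalBasis τ hτ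
  have hB : (innerₗ S : LinearMap.BilinForm ℝ S).Nondegenerate := by
    refine ⟨fun v hv => ?_, fun v hv => ?_⟩
    · exact inner_self_eq_zero.1 (hv v)
    · exact inner_self_eq_zero.1 (hv v)
  -- For `b` dual to the `τ`-orthonormal basis `c`, the covariance `∑ ⟪b i, s⟫²` is the sum of
  -- squared `c`-coordinates of `s`, that is `τ s`. The form `χ` making `b` orthonormal then gives
  -- the density.
  set b := LinearMap.BilinForm.dualBasis (innerₗ S) hB c with hb
  have hbc : ∀ (s : S) i, c.repr s i = ⟪b i, s⟫ := by
    intro s i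
    conv_rhs => rw [← c.sum_repr s, inner_sum]
    have h := LinearMap.BilinForm.apply_dualBasis_left hB c
    simp only [innerₗ_apply_apply, ← hb] at h
    simp [inner_smul_right, h]
  obtain ⟨χ, hχ, hχb⟩ := QuadraticForm.exists_posDef_isOrthonormalBasis b
  refine ⟨χ, hχ, gaussianOfVectors fun i => (b i : E), isProbabilityMeasure_gaussianOfVectors _,
    fun s t ht => ?_, fun g hg => ?_⟩
  · rw [charFun_gaussianOfVectors, hc.apply_eq_sum_sq]
    have h : ∀ i, ⟪(b i : E), s + t⟫ = c.repr s i := fun i => by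
      rw [inner_add_right, Submodule.inner_right_of_mem_orthogonal (b i).2 ht, add_zero, hbc]
      rfl
    simp only [h]
  · rw [integral_gaussianOfVectors _ hg.stronglyMeasurable,
      QuadraticForm.lebesgue_eq_addHaar χ b hχb, QuadraticForm.integral_addHaar_basis,
      ← integral_const_mul]
    refine integral_congr_ae (Eventually.of_forall fun z => ?_)
    have h1 : χ (∑ i, z i • b i) = ∑ i, z i ^ 2 := by
      rw [hχb.apply_eq_sum_sq]
      simp [Finsupp.single_apply]
    simp only [gaussianDensity_eq, h1, Fintype.card_fin, smul_eq_mul, Submodule.coe_sum,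
      Submodule.coe_smul, mul_assoc]

/-! ### Limit theorems for weighted paths. -/

namespace ArrowGraph

variable {Q A : Type*} [Fintype Q] [DecidableEq Q] [Fintype A] [DecidableEq A]
  {G : ArrowGraph Q A} {p : A → ℝ} {π : Q → ℝ} {θ : EuclideanSpace ℝ A} {φ f : Q → ℝ}

theorem nonempty_of_lam_eq_one (hθ : G.lam θ = 1) : Nonempty Q := by
  by_contra h
  rw [not_nonempty_iff] at h
  rw [lam_eq, spectrum.SpectralRadius.of_subsingleton] at hθ
  simp at hθ

theorem IsPerronPair.transfer_eq (h : G.IsPerronPair θ φ f) (hθ : G.lam θ = 1) :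
    G.transfer θ f = f := by
  rw [h.right_eigen, hθ, one_smul]

theorem IsPerronPair.isMarkov (h : G.IsPerronPair θ φ f) (hθ : G.lam θ = 1) :
    G.IsMarkov (G.transition θ f) (φ * f) :=
  isMarkov_transition h.right_pos (h.transfer_eq hθ) h.left_pos
    (fun g => by rw [h.left_eigen, hθ, one_smul]) h.normalized

theorem tendsto_zero_of_forall_inner {v : ℕ → EuclideanSpace ℝ A}
    (h : ∀ t, Tendsto (fun n => ⟪v n, t⟫) atTop (𝓝 0)) : Tendsto v atTop (𝓝 0) := by
  have h1 : Tendsto (fun n => ∑ a, ⟪v n, EuclideanSpace.basisFun A ℝ a⟫ •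
      EuclideanSpace.basisFun A ℝ a) atTop (𝓝 (∑ a, (0 : ℝ) • EuclideanSpace.basisFun A ℝ a)) :=
    tendsto_finsetSum _ fun a _ => (h _).smul_const _
  simp only [zero_smul, Finset.sum_const_zero] at h1
  refine h1.congr fun n => ?_
  conv_rhs => rw [← (EuclideanSpace.basisFun A ℝ).sum_repr' (v n)]
  simp only [real_inner_comm]

/-- The law of large numbers for weighted paths. -/
theorem Connected.tendsto_average_letterCount (hG : G.Connected) (hθ : G.lam θ = 1)
    (h : G.IsPerronPair θ φ f) (q : Q) :
    Tendsto (fun n : ℕ => (n : ℝ)⁻¹ •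
      ∑ w ∈ G.pathsFrom n q, Real.exp (-⟪θ, letterCount w⟫) •
        (letterCount w - (n : ℝ) • G.drift θ)) atTop (𝓝 0) := by
  have : Nonempty Q := ⟨q⟩
  have hM := h.isMarkov hθ
  rw [hG.drift_eq_frequency hθ h.right_pos hM]
  refine tendsto_zero_of_forall_inner fun t => ?_
  have h1 := (hM.tendsto_inv_mul_walkOp_pow_inner hG (fun q => (f q)⁻¹) t q).const_mul (f q)
  rw [mul_zero] at h1
  refine h1.congr fun n => ?_
  have h2 := sum_pathsFrom_eq_walkOp_pow (G := G) (θ := θ)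
    (x := G.frequency (G.transition θ f) (φ * f)) h.right_pos (fun y => ⟪y, t⟫) n q 0
  simp only [zero_add, smul_eq_mul] at h2
  rw [mul_left_comm, ← h2, inner_smul_left, sum_inner]
  simp only [inner_smul_left, conj_trivial]

namespace IsMarkov

/-- The asymptotic covariance of the letter count, as a quadratic form on the balanced space, and
the associated Gaussian measure. -/
theorem exists_gaussian_limit (hM : G.IsMarkov p π) (hG : G.Connected) :
    ∃ χ : QuadraticForm ℝ G.balancedSpace, χ.PosDef ∧
      ∀ g : EuclideanSpace ℝ A → ℝ, Continuous g → ∀ C : ℝ, (∀ y, ‖g y‖ ≤ C) → ∀ q,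
        Tendsto (fun n : ℕ => (G.walkOp p (G.frequency p π) ℝ ^ n)
          (fun _ y => g ((√(n : ℝ))⁻¹ • y)) q 0) atTop
          (𝓝 (((2 * Real.pi) ^ ((Module.finrank ℝ G.balancedSpace : ℝ) / 2))⁻¹ *
            ∫ y : G.balancedSpace, Real.exp (-(1 / 2) * χ y) * g y
              ∂QuadraticForm.lebesgue χ)) := by
  obtain ⟨H, U, hH, hH0, hker⟩ := hM.exists_martingale_increment hG
  let τ : QuadraticForm ℝ G.balancedSpace :=
    (QuadraticMap.weightedSumSquares ℝ fun a => π (G.source a) * p a).comp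
      (H ∘ₗ G.balancedSpace.subtype)
  have hτ : ∀ s, τ s = ∑ a, π (G.source a) * (p a * H s a ^ 2) := fun s => by
    simp [τ, QuadraticMap.weightedSumSquares_apply, sq, mul_assoc]
  have hpos : ∀ (k : A → ℝ) a, 0 ≤ π (G.source a) * (p a * k a ^ 2) := fun k a =>
    mul_nonneg (hM.stat_pos _).le (mul_nonneg (hM.pos a).le (sq_nonneg _))
  have hτpos : τ.PosDef := by
    intro s hs
    rw [hτ]
    -- All weights are positive, so zero variance forces `H s = 0`; then `s` lies both in the
    -- balanced space and in its orthogonal.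
    refine lt_of_le_of_ne (Finset.sum_nonneg fun a _ => hpos _ a) fun h => hs ?_
    have h1 := (Finset.sum_eq_zero_iff_of_nonneg fun a _ => hpos _ a).1 h.symm
    have h2 : H s = 0 := by
      ext a
      have h3 := h1 a (Finset.mem_univ a)
      simpa [(hM.stat_pos _).ne', (hM.pos a).ne'] using h3
    have h4 := (hker s).1 h2
    exact Subtype.ext (inner_self_eq_zero.1 (h4 s s.2))
  obtain ⟨χ, hχ, ν, hν, hchar, hint⟩ := exists_gaussian_of_covariance G.balancedSpace τ hτpos
  refine ⟨χ, hχ, fun g hg C hC q => ?_⟩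
  rw [← hint g hg]
  refine hM.tendsto_walkOp_pow_comp hG (H := fun t => H t) (U := fun t => U t) hH hH0 ν
    (fun t => ?_) hg hC q
  obtain ⟨s, hs, t', ht', rfl⟩ := G.balancedSpace.exists_add_mem_mem_orthogonal t
  rw [hchar ⟨s, hs⟩ t' ht', hτ, map_add, (hker t').2 ht', add_zero]

end IsMarkov

/-- The central limit theorem for weighted paths. -/
theorem Connected.tendsto_sum_pathsFrom_sub (hG : G.Connected) (hθ : G.lam θ = 1)
    (h : G.IsPerronPair θ φ f) {g : EuclideanSpace ℝ A → ℝ} (hg : Continuous g)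
    (hgc : HasCompactSupport g) {c : ℝ} (q : Q)
    (hlim : Tendsto (fun n : ℕ =>
      (G.walkOp (G.transition θ f) (G.frequency (G.transition θ f) (φ * f)) ℝ ^ n)
        (fun _ y => g ((√(n : ℝ))⁻¹ • y)) q 0) atTop (𝓝 c)) :
    Tendsto (fun n : ℕ =>
      (∑ w ∈ G.pathsFrom n q, Real.exp (-⟪θ, letterCount w⟫) *
        g ((√(n : ℝ))⁻¹ • (letterCount w - (n : ℝ) • G.drift θ))) -
        (G.period q : ℝ) * (∑ q' ∈ G.cyclicClass q n, φ q') * f q * c) atTop (𝓝 0) := by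
  have : Nonempty Q := ⟨q⟩
  have hM := h.isMarkov hθ
  rw [hG.drift_eq_frequency hθ h.right_pos hM]
  set x := G.frequency (G.transition θ f) (φ * f)
  set ψ : Q → ℝ := fun q => (f q)⁻¹ with hψ
  obtain ⟨C, hC⟩ := hgc.exists_bound_of_continuous hg
  have h1 := hM.tendsto_walkOp_pow_mul_sub (x := x) hG ψ
    (hgc.uniformContinuous_of_continuous hg) hC q
  have h2 : Tendsto (fun n : ℕ => G.cyclicMean (φ * f) ψ n q *
      ((G.walkOp (G.transition θ f) x ℝ ^ n) (fun _ y => g ((√(n : ℝ))⁻¹ • y)) q 0 - c)) atTop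
      (𝓝 0) := by
    refine bdd_le_mul_tendsto_zero' ‖ψ‖ (Eventually.of_forall fun n =>
      hM.abs_cyclicMean_le hG ψ n q) ?_
    simpa using hlim.sub_const c
  have h3 := (h1.add h2).const_mul (f q)
  rw [add_zero, mul_zero] at h3
  refine h3.congr fun n => ?_
  have h4 := sum_pathsFrom_eq_walkOp_pow (G := G) (θ := θ) (x := x) h.right_pos
    (fun y => g ((√(n : ℝ))⁻¹ • y)) n q 0
  simp only [zero_add, smul_eq_mul] at h4
  -- The stationary law `φ * f` cancels the weight `1 / f`, leaving the `φ`-mass of the class.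
  have h5 : G.cyclicMean (φ * f) ψ n q = G.period q * ∑ q' ∈ G.cyclicClass q n, φ q' := by
    rw [cyclicMean]
    congr 1
    refine Finset.sum_congr rfl fun q' _ => ?_
    rw [hψ, Pi.mul_apply, mul_inv_cancel_right₀ (h.right_pos q').ne']
  rw [h4, ← h5]
  ring

end ArrowGraph

theorem mainTheorem4 {Q A : Type*} [Fintype Q] [DecidableEq Q] [Fintype A] [DecidableEq A]
    (G : ArrowGraph Q A) (hG : G.Connected) (θ : EuclideanSpace ℝ A) (hθ : G.lam θ = 1) :
    DifferentiableAt ℝ G.lam θ ∧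
    (∃! u : (Q → ℝ) × (Q → ℝ), G.IsPerronPair θ u.1 u.2) ∧
    (∀ q : Q, Tendsto (fun n : ℕ => (n : ℝ)⁻¹ •
        ∑ w ∈ G.pathsFrom n q, Real.exp (-⟪θ, ArrowGraph.letterCount w⟫) •
          (ArrowGraph.letterCount w - (n : ℝ) • G.drift θ)) atTop (𝓝 0)) ∧
    ∃ χ : QuadraticForm ℝ G.balancedSpace, χ.PosDef ∧
      ∀ φ f : Q → ℝ, G.IsPerronPair θ φ f →
      ∀ (q : Q) (g : EuclideanSpace ℝ A → ℝ), Continuous g → HasCompactSupport g →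
        Tendsto (fun n : ℕ =>
          (∑ w ∈ G.pathsFrom n q, Real.exp (-⟪θ, ArrowGraph.letterCount w⟫) *
              g ((√(n : ℝ))⁻¹ • (ArrowGraph.letterCount w - (n : ℝ) • G.drift θ)))
          - (G.period q : ℝ) * (∑ q' ∈ G.cyclicClass q n, φ q') * f q
              / (2 * Real.pi) ^ ((Module.finrank ℝ G.balancedSpace : ℝ) / 2)
            * ∫ y : G.balancedSpace, Real.exp (-(1 / 2) * χ y) * g (y : EuclideanSpace ℝ A)
                ∂(QuadraticForm.lebesgue χ))
          atTop (𝓝 0) := by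
  have : Nonempty Q := ArrowGraph.nonempty_of_lam_eq_one hθ
  have hex := hG.existsUnique_isPerronPair hθ
  obtain ⟨⟨φ₀, f₀⟩, h₀, huniq⟩ := hex
  have h₀' : G.IsPerronPair θ φ₀ f₀ := h₀
  have hM := h₀'.isMarkov hθ
  obtain ⟨χ, hχ, hlim⟩ := hM.exists_gaussian_limit hG
  refine ⟨(hG.hasGradientAt_lam h₀'.right_pos hM).differentiableAt, ⟨_, h₀, huniq⟩,
    hG.tendsto_average_letterCount hθ h₀', χ, hχ, fun φ f h q g hg hgc => ?_⟩
  -- `χ` was built from one Perron pair; uniqueness identifies every other pair with it.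
  obtain ⟨rfl, rfl⟩ : φ = φ₀ ∧ f = f₀ := Prod.ext_iff.1 (huniq (φ, f) h)
  obtain ⟨C, hC⟩ := hgc.exists_bound_of_continuous hg
  refine (hG.tendsto_sum_pathsFrom_sub hθ h hg hgc q (hlim g hg C hC q)).congr fun n => ?_
  rw [← mul_assoc, ← div_eq_mul_inv]
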